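/- Let $d\ge 2$ be an integer and identify the circle $\mathbb S^1$ with $\mathbb R/\mathbb Z$. Let $\mathcal T_d^*$ be the class of orientation preserving covering maps $h:\mathbb S^1\to\mathbb S^1$ of degree $d$ (that is, $h$ has a lift $H:\mathbb R\to\mathbb R$ with $H(t+1)=H(t)+d$) such that $h$ is a $C^1$ local diffeomorphism whose derivative $Dh$ has bounded variation, and such that every periodic point $p$ of $h$, of period $s$, has a neighbourhood $U(p)$ with $Dh^s(x)>1$ for all $x\in U(p)\setminus\{p\}$. Here $h^s$ denotes the $s$-th iterate and derivatives are taken in the coordinate of $\mathbb R$. Let $\operatorname{Par}(h)$ denote the set of parabolic periodic points of $h$, i.e. the periodic points $p$, of period $s$, with $Dh^s(p)=1$. **Theorem.** For every $h\in\mathcal T_d^*$ the set $\operatorname{Par}(h)$ is finite. Moreover, there exist a positive integer $N$ and a real analytic function $\rho:\mathbb S^1\to(0,\infty)$ such that $$\frac{\rho(h^N(x))}{\rho(x)}\,Dh^N(x)>1\qquad\text{for all }x\in\mathbb S^1\setminus\operatorname{Par}(h).$$ -/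

import Mathlib

open Set Filter Topology

/-- The derivative at `x` of a self-map `h` of the circle `ℝ / ℤ`, in the coordinate of `ℝ`:
the derivative at `t = 0` of the displacement `h (x + t) - h x ∈ ℝ / ℤ`, which is read as a real
number through its representative in `(-1/2, 1/2]`. -/
noncomputable def circleDeriv (h : UnitAddCircle → UnitAddCircle) (x : UnitAddCircle) : ℝ :=
  deriv (fun t : ℝ =>
    ((AddCircle.equivIoc (1 : ℝ) (-1 / 2) (h (x + (t : UnitAddCircle)) - h x) : _) : ℝ)) 0

/-- `H : ℝ → ℝ` is a continuous lift of the degree `d` circle map `h`. -/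
structure IsCircleLift (d : ℕ) (h : UnitAddCircle → UnitAddCircle) (H : ℝ → ℝ) : Prop where
  continuous : Continuous H
  lift : ∀ t : ℝ, ((H t : ℝ) : UnitAddCircle) = h (t : UnitAddCircle)
  degree : ∀ t : ℝ, H (t + 1) = H t + d

/-- The derivative of a circle map is the ordinary derivative of its lift. -/
theorem IsCircleLift.circleDeriv_eq {d : ℕ} {h : UnitAddCircle → UnitAddCircle} {H : ℝ → ℝ}
    (hH : IsCircleLift d h H) (a : ℝ) : circleDeriv h (a : UnitAddCircle) = deriv H a := by
  have key : (fun t : ℝ => ((AddCircle.equivIoc (1 : ℝ) (-1 / 2)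
      (h ((a : UnitAddCircle) + (t : UnitAddCircle)) - h (a : UnitAddCircle)) : _) : ℝ))
      =ᶠ[𝓝 0] fun t : ℝ => H (a + t) - H a := by
    have hc : ContinuousAt (fun t : ℝ => H (a + t) - H a) 0 := by
      have := hH.continuous
      fun_prop
    have hn : Ioo (-1 / 2 : ℝ) (1 / 2) ∈ 𝓝 (H (a + 0) - H a) := by
      apply Ioo_mem_nhds <;> norm_num
    filter_upwards [hc hn] with t ht
    have ht' : H (a + t) - H a ∈ Ioo (-1 / 2 : ℝ) (1 / 2) := ht
    rw [← AddCircle.coe_add, ← hH.lift, ← hH.lift, ← AddCircle.coe_sub,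
      AddCircle.equivIoc_coe_of_mem]
    exact ⟨ht'.1, by linarith [ht'.2]⟩
  unfold circleDeriv
  rw [key.deriv_eq, deriv_sub_const]
  simpa using deriv_comp_const_add H a 0

/-- The class `F_d^{1+BV}` of locally diffeomorphic, orientation preserving `C^{1+BV}` coverings of
the circle of degree `d ≥ 1`: the maps with a lift `H` of degree `d` that is `C^1` with positive
derivative (so `H` is a diffeomorphism of `ℝ`, and the map is a covering), such that the
derivative is of bounded variation on the circle. -/
def IsCoveringBV (d : ℕ) (h : UnitAddCircle → UnitAddCircle) : Prop :=
  ∃ H : ℝ → ℝ, IsCircleLift d h H ∧ ContDiff ℝ 1 H ∧ (∀ t, 0 < deriv H t) ∧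
    BoundedVariationOn (deriv H) (Icc 0 1)

/-- The class `T_d^*`: the maps of `F_d^{1+BV}` such that each periodic point `p`, of period `s`,
has a punctured neighbourhood on which `D h^s > 1`. -/
structure IsTdStar (d : ℕ) (h : UnitAddCircle → UnitAddCircle) : Prop where
  coveringBV : IsCoveringBV d h
  weaklyExpanding : ∀ p ∈ Function.periodicPts h,
    ∃ U ∈ 𝓝 p, ∀ x ∈ U \ {p}, 1 < circleDeriv (h^[Function.minimalPeriod h p]) x

/-- The set `Par(h)` of parabolic periodic points, for orientation preserving `h`: the periodic
points whose multiplier is `1`. -/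
def parabolicPts (h : UnitAddCircle → UnitAddCircle) : Set UnitAddCircle :=
  {p | p ∈ Function.periodicPts h ∧ circleDeriv (h^[Function.minimalPeriod h p]) p = 1}

/-- `ρ` is real analytic on the circle `ℝ / ℤ`: its `1`-periodic lift to `ℝ` is. -/
def IsAnalyticOnCircle (ρ : UnitAddCircle → ℝ) : Prop :=
  AnalyticOnNhd ℝ (fun t : ℝ => ρ (t : UnitAddCircle)) univ

/-!
Let `H` be a lift of `h`. The sum of `log H'` along an orbit segment of length `n`, `expo H n`, is
the logarithm of the derivative of `H^[n]`. The theorem asks for a real analytic periodic `u` such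
that `log (H^[N])' + u ∘ H^[N] - u` is positive except at the parabolic points; then `ρ = exp u`.

The main step is that *the derivatives of the iterates are unbounded along every orbit that does
not end in a parabolic periodic orbit* (`exists_parabolic_of_bounded`). Bounded variation of
`log H'` bounds the distortion of an iterate on an interval whose images are disjoint on the circle
(`sum_control_le`). Since periodic points repel and the degree is at least `2`, there are no
wandering intervals, so that an interval which is mapped by a high iterate, with bounded distortion,
onto an interval of definite length is short (`exists_forall_length_le`), and the iterate expands
there. Bounded distortion is available at first entries into a nice interval, that is one whose
endpoints have orbits avoiding it (`sum_control_le_of_first_entry`). An orbit of bounded expansion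
therefore stays away from every periodic orbit that it does not hit
(`eventually_not_near_periodic`). Away from a fixed point, cut the circle by the preimages of that
point under `H^[m]` and consider the leftmost interval which the orbit visits infinitely often. It
leads to a nice interval, and long returns to it expand; so there are returns of bounded length at
every level `m`, and as `m` grows these accumulate at a periodic point, a contradiction
(`exists_periodic_accumulation`).

Orbits that pass close to a parabolic point gain much expansion before they leave its neighbourhood
(`eventually_exit`). Together with the main step this implies that there are only finitely many
parabolic points (`finite_parabolic`), and, by compactness, that the derivatives of all iterates
have a common positive lower bound (`ParabolicGauge.exists_le_expo`).

Replace `H` by an iterate that fixes all parabolic points. If `ψ ≥ 0` is small and vanishes only at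
the parabolic points, then the infimum `v` of the Birkhoff sums of `log H' - ψ` is a minimum over
boundedly many times. It is continuous, satisfies `ψ + v ≤ log H' + v ∘ H`, and vanishes near the
parabolic points (`ParabolicGauge.exists_coboundary`). It remains to make `v` analytic. Let `Q` be
the product of the functions `sin (π (x - p)) ^ 2` over the parabolic points `p`, and let
`u = Q * (κ + τ)`, where `κ > 0` is small and `τ` is a trigonometric polynomial close to `v / Q`
that, in addition, has a small Lipschitz constant near the parabolic points
(`exists_analytic_approx_of_eq_zero`). Away from the parabolic points `u` is close to `v`, and `ψ`
is bounded below. Near them `log H' > 0`, and `u` increases along orbits, because `Q` has double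
zeros and the points move away from the zeros (`exists_analytic_coboundary`).
-/

/-! ### Weakly expanding lifts -/

/-- The logarithm of the derivative of a map of the line. -/
noncomputable def logSlope (H : ℝ → ℝ) (t : ℝ) : ℝ := Real.log (deriv H t)

/-- The logarithm of the derivative of `H^[n]`, as a Birkhoff sum. -/
noncomputable def expo (H : ℝ → ℝ) (n : ℕ) (x : ℝ) : ℝ := birkhoffSum H (logSlope H) n x

/-- The lifts `H : ℝ → ℝ` of the circle maps of the theorem, in a form that is stable under
iteration, translation and reflection. The bounded variation of `log H'` is recorded by a monotone
function `P` with `P (t + 1) = P t + V`, whose increments dominate those of `log H'`. The last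
field says that each periodic point (mod `1`) is weakly expanding. -/
structure WeaklyExpandingLift (d : ℕ) (H P : ℝ → ℝ) (V : ℝ) : Prop where
  two_le : 2 ≤ d
  differentiable : Differentiable ℝ H
  continuous_deriv : Continuous (deriv H)
  deriv_pos : ∀ t, 0 < deriv H t
  map_add_one : ∀ t, H (t + 1) = H t + d
  monotone : Monotone P
  control_add_one : ∀ t, P (t + 1) = P t + V
  abs_sub_le : ∀ x y, x ≤ y → |logSlope H y - logSlope H x| ≤ P y - P x
  eventually_pos : ∀ r : ℕ, 1 ≤ r → ∀ (k : ℤ) (p : ℝ), H^[r] p = p + k →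
    ∀ᶠ x in 𝓝[≠] p, 0 < expo H r x

theorem expo_zero (H : ℝ → ℝ) (x : ℝ) : expo H 0 x = 0 := birkhoffSum_zero _ _ _

theorem expo_one (H : ℝ → ℝ) (x : ℝ) : expo H 1 x = logSlope H x := birkhoffSum_one _ _ _

theorem expo_succ (H : ℝ → ℝ) (n : ℕ) (x : ℝ) :
    expo H (n + 1) x = expo H n x + logSlope H (H^[n] x) := birkhoffSum_succ _ _ _ _

theorem expo_add (H : ℝ → ℝ) (m n : ℕ) (x : ℝ) :
    expo H (m + n) x = expo H m x + expo H n (H^[m] x) := birkhoffSum_add _ _ _ _ _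

theorem expo_def (H : ℝ → ℝ) (n : ℕ) (x : ℝ) :
    expo H n x = ∑ j ∈ Finset.range n, logSlope H (H^[j] x) := rfl

theorem hasDerivAt_iterate_exp_expo {H : ℝ → ℝ} (hd : Differentiable ℝ H)
    (hpos : ∀ t, 0 < deriv H t) (n : ℕ) (x : ℝ) :
    HasDerivAt H^[n] (Real.exp (expo H n x)) x := by
  induction n with
  | zero => simpa [expo_zero] using hasDerivAt_id x
  | succ n ih =>
    rw [Function.iterate_succ', expo_succ, Real.exp_add, mul_comm]
    refine HasDerivAt.comp x ?_ ih
    rw [logSlope, Real.exp_log (hpos _)]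
    exact (hd _).hasDerivAt

namespace WeaklyExpandingLift

variable {d : ℕ} {H P : ℝ → ℝ} {V : ℝ}

theorem continuous (R : WeaklyExpandingLift d H P V) : Continuous H :=
  R.differentiable.continuous

theorem strictMono (R : WeaklyExpandingLift d H P V) : StrictMono H :=
  strictMono_of_deriv_pos R.deriv_pos

theorem strictMono_iterate (R : WeaklyExpandingLift d H P V) (n : ℕ) : StrictMono H^[n] :=
  R.strictMono.iterate n

theorem continuous_iterate (R : WeaklyExpandingLift d H P V) (n : ℕ) : Continuous H^[n] :=
  R.continuous.iterate n

theorem continuous_logSlope (R : WeaklyExpandingLift d H P V) : Continuous (logSlope H) :=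
  R.continuous_deriv.log fun t => (R.deriv_pos t).ne'

theorem continuous_expo (R : WeaklyExpandingLift d H P V) (n : ℕ) : Continuous (expo H n) := by
  unfold expo birkhoffSum
  exact continuous_finsetSum _ fun j _ => R.continuous_logSlope.comp (R.continuous_iterate j)

theorem map_add_int (R : WeaklyExpandingLift d H P V) (t : ℝ) (k : ℤ) :
    H (t + k) = H t + d * k := by
  have hn : ∀ (n : ℕ) (t : ℝ), H (t + n) = H t + d * n := by
    intro n
    induction n with
    | zero => simp
    | succ n ih =>
      intro t
      push_cast
      rw [← add_assoc, R.map_add_one, ih]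
      ring
  obtain ⟨n, rfl | rfl⟩ := k.eq_nat_or_neg
  · simpa using hn n t
  · have := hn n (t - n)
    simp only [sub_add_cancel] at this
    push_cast
    rw [← sub_eq_add_neg]
    linarith

theorem iterate_add_int (R : WeaklyExpandingLift d H P V) (n : ℕ) (t : ℝ) (k : ℤ) :
    H^[n] (t + k) = H^[n] t + (d : ℝ) ^ n * k := by
  induction n with
  | zero => simp
  | succ n ih =>
    rw [Function.iterate_succ_apply', ih, Function.iterate_succ_apply']
    have := R.map_add_int (H^[n] t) ((d : ℤ) ^ n * k)
    push_cast at this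
    rw [this]
    ring

/-- Integer translates of a point have orbits that differ by integers. -/
theorem exists_iterate_add_int (R : WeaklyExpandingLift d H P V) (n : ℕ) (k : ℤ) :
    ∃ l : ℤ, ∀ t, H^[n] (t + k) = H^[n] t + l :=
  ⟨(d : ℤ) ^ n * k, fun t => by rw [R.iterate_add_int]; push_cast; ring⟩

theorem control_add_int (R : WeaklyExpandingLift d H P V) (t : ℝ) (k : ℤ) :
    P (t + k) = P t + k * V := by
  have hn : ∀ (n : ℕ) (t : ℝ), P (t + n) = P t + n * V := by
    intro n
    induction n with
    | zero => simp
    | succ n ih =>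
      intro t
      push_cast
      rw [← add_assoc, R.control_add_one, ih]
      ring
  obtain ⟨n, rfl | rfl⟩ := k.eq_nat_or_neg
  · simpa using hn n t
  · have := hn n (t - n)
    simp only [sub_add_cancel] at this
    push_cast
    rw [← sub_eq_add_neg]
    linarith

theorem logSlope_add_int (R : WeaklyExpandingLift d H P V) (t : ℝ) (k : ℤ) :
    logSlope H (t + k) = logSlope H t := by
  have h : (fun s => H (s + k)) = fun s => H s + d * k := funext fun s => R.map_add_int s k
  have h2 := congrArg (fun f => deriv f t) h
  simp only [deriv_comp_add_const, deriv_add_const] at h2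
  simp [logSlope, h2]

theorem expo_add_int (R : WeaklyExpandingLift d H P V) (n : ℕ) (t : ℝ) (k : ℤ) :
    expo H n (t + k) = expo H n t := by
  rw [expo_def, expo_def]
  refine Finset.sum_congr rfl fun j _ => ?_
  obtain ⟨l, hl⟩ := R.exists_iterate_add_int j k
  rw [hl, R.logSlope_add_int]

theorem hasDerivAt_iterate (R : WeaklyExpandingLift d H P V) (n : ℕ) (x : ℝ) :
    HasDerivAt H^[n] (Real.exp (expo H n x)) x :=
  hasDerivAt_iterate_exp_expo R.differentiable R.deriv_pos n x

theorem deriv_iterate (R : WeaklyExpandingLift d H P V) (n : ℕ) (x : ℝ) :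
    deriv H^[n] x = Real.exp (expo H n x) := (R.hasDerivAt_iterate n x).deriv

/-- Mean value theorem for the iterates. -/
theorem exists_iterate_sub_eq (R : WeaklyExpandingLift d H P V) (n : ℕ) {u v : ℝ} (h : u < v) :
    ∃ s ∈ Ioo u v, H^[n] v - H^[n] u = Real.exp (expo H n s) * (v - u) := by
  obtain ⟨s, hs, he⟩ := exists_hasDerivAt_eq_slope H^[n] _ h
    (R.continuous_iterate n).continuousOn fun x _ => R.hasDerivAt_iterate n x
  refine ⟨s, hs, ?_⟩
  rw [he, div_mul_cancel₀]
  linarith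

theorem control_nonneg (R : WeaklyExpandingLift d H P V) : 0 ≤ V := by
  have := R.control_add_one 0
  have := R.monotone (show (0 : ℝ) ≤ 0 + 1 by norm_num)
  linarith

/-- The distortion of `H^[n]` on an interval is at most the total increment of `P` along the
orbit of the interval. -/
theorem abs_expo_sub_le (R : WeaklyExpandingLift d H P V) (n : ℕ) {u v s t : ℝ}
    (hs : s ∈ Icc u v) (ht : t ∈ Icc u v) :
    |expo H n s - expo H n t| ≤ ∑ j ∈ Finset.range n, (P (H^[j] v) - P (H^[j] u)) := by
  rw [expo_def, expo_def, ← Finset.sum_sub_distrib]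
  refine (Finset.abs_sum_le_sum_abs _ _).trans (Finset.sum_le_sum fun j _ => ?_)
  have m := (R.strictMono_iterate j).monotone
  have key : ∀ a b, a ∈ Icc u v → b ∈ Icc u v → a ≤ b →
      |logSlope H (H^[j] b) - logSlope H (H^[j] a)| ≤ P (H^[j] v) - P (H^[j] u) := by
    intro a b ha hb hab
    refine (R.abs_sub_le _ _ (m hab)).trans ?_
    have := R.monotone (m ha.1)
    have := R.monotone (m hb.2)
    linarith
  rcases le_total s t with h | h
  · rw [abs_sub_comm]
    exact key s t hs ht h
  · exact key t s ht hs h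

/-- An interval on which `H^[n]` has distortion at most `K` and which is mapped onto an interval
of length `c` is expanded by at least `exp (-K) * c / length`. -/
theorem le_expo (R : WeaklyExpandingLift d H P V) {n : ℕ} {u v t K L : ℝ} (huv : u < v)
    (ht : t ∈ Icc u v) (hK : ∑ j ∈ Finset.range n, (P (H^[j] v) - P (H^[j] u)) ≤ K)
    (hL : Real.exp (K + L) * (v - u) ≤ H^[n] v - H^[n] u) : L ≤ expo H n t := by
  obtain ⟨s, hs, he⟩ := R.exists_iterate_sub_eq n huv
  have h1 := (R.abs_expo_sub_le n (Ioo_subset_Icc_self hs) ht).trans hK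
  rw [he] at hL
  have h2 := Real.exp_le_exp.1 (le_of_mul_le_mul_right hL (by linarith))
  linarith [(abs_le.1 h1).2]

/-! ### Iterates, translates and reflections -/

theorem logSlope_iterate (R : WeaklyExpandingLift d H P V) (r : ℕ) :
    logSlope H^[r] = expo H r := by
  ext x
  rw [logSlope, R.deriv_iterate, Real.log_exp]

theorem expo_iterate (R : WeaklyExpandingLift d H P V) (r n : ℕ) (x : ℝ) :
    expo H^[r] n x = expo H (r * n) x := by
  induction n with
  | zero => simp [expo_zero]
  | succ n ih =>
    rw [expo_succ, ih, Nat.mul_succ, expo_add, R.logSlope_iterate, Function.iterate_mul]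

theorem iterate (R : WeaklyExpandingLift d H P V) {r : ℕ} (hr : 1 ≤ r) :
    WeaklyExpandingLift (d ^ r) H^[r] (fun x => ∑ j ∈ Finset.range r, P (H^[j] x))
      (∑ j ∈ Finset.range r, (d : ℝ) ^ j * V) where
  two_le := R.two_le.trans (Nat.le_self_pow (by omega) d)
  differentiable x := (R.hasDerivAt_iterate r x).differentiableAt
  continuous_deriv := by
    rw [show deriv H^[r] = fun x => Real.exp (expo H r x) from funext (R.deriv_iterate r)]
    exact Real.continuous_exp.comp (R.continuous_expo r)
  deriv_pos t := by
    rw [R.deriv_iterate]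
    exact Real.exp_pos _
  map_add_one t := by
    simpa using R.iterate_add_int r t 1
  monotone x y h := Finset.sum_le_sum fun j _ =>
    R.monotone ((R.strictMono_iterate j).monotone h)
  control_add_one t := by
    rw [← Finset.sum_add_distrib]
    refine Finset.sum_congr rfl fun j _ => ?_
    have h1 := R.iterate_add_int j t 1
    have h2 := R.control_add_int (H^[j] t) ((d : ℤ) ^ j)
    push_cast at h1 h2
    rw [h1, mul_one, h2]
  abs_sub_le x y h := by
    rw [R.logSlope_iterate, ← Finset.sum_sub_distrib]
    exact R.abs_expo_sub_le r ⟨h, le_rfl⟩ ⟨le_rfl, h⟩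
  eventually_pos n hn k p hp := by
    rw [← Function.iterate_mul] at hp
    simpa only [R.expo_iterate] using R.eventually_pos (r * n) (Nat.mul_pos hr hn) k p hp

/-- `H` in the coordinate centred at `z`, with the integer `k` subtracted. -/
def shift (H : ℝ → ℝ) (z : ℝ) (k : ℤ) (x : ℝ) : ℝ := H (x + z) - z - k

theorem shift_iterate (R : WeaklyExpandingLift d H P V) (z : ℝ) (k : ℤ) (n : ℕ) :
    ∃ l : ℤ, ∀ x, (shift H z k)^[n] x = H^[n] (x + z) - z - l := by
  induction n with
  | zero => exact ⟨0, fun x => by simp⟩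
  | succ n ih =>
    obtain ⟨l, hl⟩ := ih
    refine ⟨k + d * l, fun x => ?_⟩
    rw [Function.iterate_succ_apply', hl, shift, Function.iterate_succ_apply']
    have := R.map_add_int (H^[n] (x + z)) (-l)
    push_cast at this ⊢
    rw [show H^[n] (x + z) - z - (l : ℝ) + z = H^[n] (x + z) + -l by ring, this]
    ring

theorem logSlope_shift (H : ℝ → ℝ) (z : ℝ) (k : ℤ) (x : ℝ) :
    logSlope (shift H z k) x = logSlope H (x + z) := by
  unfold logSlope shift
  rw [deriv_sub_const, deriv_sub_const, deriv_comp_add_const]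

theorem expo_shift (R : WeaklyExpandingLift d H P V) (z : ℝ) (k : ℤ) (n : ℕ) (x : ℝ) :
    expo (shift H z k) n x = expo H n (x + z) := by
  rw [expo_def, expo_def]
  refine Finset.sum_congr rfl fun j _ => ?_
  obtain ⟨l, hl⟩ := R.shift_iterate z k j
  rw [logSlope_shift, hl, show H^[j] (x + z) - z - (l : ℝ) + z = H^[j] (x + z) + ((-l : ℤ) : ℝ) by
    push_cast; ring, R.logSlope_add_int]

theorem shift_lift (R : WeaklyExpandingLift d H P V) (z : ℝ) (k : ℤ) :
    WeaklyExpandingLift d (shift H z k) (fun x => P (x + z)) V where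
  two_le := R.two_le
  differentiable := by
    have := R.differentiable
    unfold shift
    fun_prop
  continuous_deriv := by
    have h : deriv (shift H z k) = fun x => deriv H (x + z) := by
      ext x
      unfold shift
      rw [deriv_sub_const, deriv_sub_const, deriv_comp_add_const]
    rw [h]
    exact R.continuous_deriv.comp (continuous_id.add continuous_const)
  deriv_pos t := by
    unfold shift
    rw [deriv_sub_const, deriv_sub_const, deriv_comp_add_const]
    exact R.deriv_pos _
  map_add_one t := by
    unfold shift
    rw [add_right_comm, R.map_add_one]
    ring
  monotone x y h := R.monotone (by linarith)
  control_add_one t := by rw [add_right_comm, R.control_add_one]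
  abs_sub_le x y h := by
    rw [logSlope_shift, logSlope_shift]
    exact R.abs_sub_le _ _ (by linarith)
  eventually_pos r hr l p hp := by
    obtain ⟨m, hm⟩ := R.shift_iterate z k r
    rw [hm] at hp
    have h := R.eventually_pos r hr (l + m) (p + z) (by push_cast; linarith)
    simp only [R.expo_shift]
    have ht : Tendsto (fun x : ℝ => x + z) (𝓝[≠] p) (𝓝[≠] (p + z)) := by
      refine tendsto_nhdsWithin_iff.2 ⟨?_, ?_⟩
      · exact ((continuous_id.add continuous_const).tendsto p).mono_left nhdsWithin_le_nhds
      · filter_upwards [self_mem_nhdsWithin] with x hx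
        simpa using hx
    exact ht.eventually h

/-- `H` in the reversed coordinate. -/
def reflect (H : ℝ → ℝ) (x : ℝ) : ℝ := -H (-x)

theorem reflect_iterate (H : ℝ → ℝ) (n : ℕ) (x : ℝ) :
    (reflect H)^[n] x = -H^[n] (-x) := by
  induction n with
  | zero => simp
  | succ n ih => rw [Function.iterate_succ_apply', ih, Function.iterate_succ_apply', reflect,
      neg_neg]

theorem deriv_reflect (H : ℝ → ℝ) (x : ℝ) : deriv (reflect H) x = deriv H (-x) := by
  unfold reflect
  rw [deriv.fun_neg, deriv_comp_neg, neg_neg]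

theorem expo_reflect (H : ℝ → ℝ) (n : ℕ) (x : ℝ) :
    expo (reflect H) n x = expo H n (-x) := by
  rw [expo_def, expo_def]
  refine Finset.sum_congr rfl fun j _ => ?_
  rw [logSlope, deriv_reflect, reflect_iterate, neg_neg, logSlope]

theorem reflect_lift (R : WeaklyExpandingLift d H P V) :
    WeaklyExpandingLift d (reflect H) (fun x => -P (-x)) V where
  two_le := R.two_le
  differentiable := by
    have := R.differentiable
    unfold reflect
    fun_prop
  continuous_deriv := by
    rw [show deriv (reflect H) = fun x => deriv H (-x) from funext (deriv_reflect H)]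
    exact R.continuous_deriv.comp continuous_neg
  deriv_pos t := by
    rw [deriv_reflect]
    exact R.deriv_pos _
  map_add_one t := by
    have := R.map_add_one (-(t + 1))
    unfold reflect
    rw [show -(t + 1) + 1 = -t by ring] at this
    linarith
  monotone x y h := neg_le_neg (R.monotone (neg_le_neg h))
  control_add_one t := by
    have := R.control_add_one (-(t + 1))
    rw [show -(t + 1) + 1 = -t by ring] at this
    linarith
  abs_sub_le x y h := by
    rw [logSlope, logSlope, deriv_reflect, deriv_reflect, abs_sub_comm]
    have := R.abs_sub_le (-y) (-x) (by linarith)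
    rw [logSlope, logSlope] at this
    linarith
  eventually_pos r hr l p hp := by
    rw [reflect_iterate] at hp
    have h := R.eventually_pos r hr (-l) (-p) (by push_cast; linarith)
    simp only [expo_reflect]
    have ht : Tendsto (fun x : ℝ => -x) (𝓝[≠] p) (𝓝[≠] (-p)) := by
      refine tendsto_nhdsWithin_iff.2 ⟨?_, ?_⟩
      · exact (continuous_neg.tendsto p).mono_left nhdsWithin_le_nhds
      · filter_upwards [self_mem_nhdsWithin] with x hx
        simpa using hx
    exact ht.eventually h

/-! ### Escape from fixed points and wandering intervals -/

/-- An interval longer than the circle has images longer than the circle. -/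
theorem iterate_sub_gt_one_of_le (R : WeaklyExpandingLift d H P V) {x y : ℝ} {m n : ℕ}
    (hmn : m ≤ n) (h : 1 < H^[m] y - H^[m] x) : 1 < H^[n] y - H^[n] x := by
  induction n, hmn using Nat.le_induction with
  | base => exact h
  | succ n _ ih =>
    rw [Function.iterate_succ_apply', Function.iterate_succ_apply']
    have h1 : H (H^[n] x + 1) < H (H^[n] y) := R.strictMono (by linarith)
    rw [R.map_add_one] at h1
    have : (2 : ℝ) ≤ d := by exact_mod_cast R.two_le
    linarith

/-- The displacement of `H` grows at least linearly, since the degree is at least `2`. -/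
theorem le_map_sub (R : WeaklyExpandingLift d H P V) {x : ℝ} (hx : 0 ≤ x) :
    H 0 + x - 2 ≤ H x - x := by
  have h1 : H (0 + (⌊x⌋ : ℝ)) ≤ H x := R.strictMono.monotone (by simpa using Int.floor_le x)
  rw [R.map_add_int] at h1
  have h2 : (0 : ℝ) ≤ ⌊x⌋ := by exact_mod_cast Int.floor_nonneg.2 hx
  have h3 : (2 : ℝ) ≤ d := by exact_mod_cast R.two_le
  have h4 := (Int.lt_floor_add_one x).le
  nlinarith

theorem tendsto_atTop (R : WeaklyExpandingLift d H P V) : Tendsto H atTop atTop := by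
  refine tendsto_atTop_mono' _ (f₁ := fun x => x + (H 0 - 2)) ?_
    (tendsto_atTop_add_const_right _ _ tendsto_id)
  filter_upwards [eventually_ge_atTop 0] with x hx
  have := R.le_map_sub hx
  linarith

theorem surjective (R : WeaklyExpandingLift d H P V) : Function.Surjective H := by
  refine R.continuous.surjective R.tendsto_atTop ?_
  have h := tendsto_neg_atTop_atBot.comp (R.reflect_lift.tendsto_atTop.comp tendsto_neg_atBot_atTop)
  refine h.congr fun x => ?_
  simp [reflect]

theorem surjective_iterate (R : WeaklyExpandingLift d H P V) (n : ℕ) :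
    Function.Surjective H^[n] := R.surjective.iterate n

/-- Near a point that is fixed modulo `1` the map is strictly expanding. -/
theorem exists_expanding (R : WeaklyExpandingLift d H P V) {p : ℝ} {k : ℤ} (hp : H p = p + k) :
    ∃ δ > 0, ∀ x y, |x - p| < δ → |y - p| < δ → (p ≤ x ∨ y ≤ p) → x < y →
      y - x < H y - H x := by
  have h := R.eventually_pos 1 le_rfl k p (by simpa using hp)
  rw [eventually_nhdsWithin_iff, Metric.eventually_nhds_iff] at h
  obtain ⟨δ, hδ, h⟩ := h
  refine ⟨δ, hδ, fun x y hx hy hxy hlt => ?_⟩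
  obtain ⟨s, hs, he⟩ := R.exists_iterate_sub_eq 1 hlt
  rw [abs_lt] at hx hy
  have hs1 : s ≠ p := by
    rintro rfl
    rcases hxy with h' | h'
    · exact absurd hs.1 (not_lt.2 h')
    · exact absurd hs.2 (not_lt.2 h')
  have := h (y := s) (by rw [Real.dist_eq, abs_lt]; constructor <;> linarith [hs.1, hs.2]) hs1
  have := Real.one_lt_exp_iff.2 this
  simp only [Function.iterate_one] at he
  rw [he]
  nlinarith

/-- All periodic points repel, so an orbit that moves to the right does so without bound. -/
theorem tendsto_iterate_atTop (R : WeaklyExpandingLift d H P V) {s : ℝ} (hs : s < H s) :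
    Tendsto (fun m => H^[m] s) atTop atTop := by
  have hlt : ∀ m, H^[m] s < H^[m + 1] s := fun m => by
    rw [Function.iterate_succ_apply]
    exact R.strictMono_iterate m hs
  have hmono : StrictMono fun m => H^[m] s := strictMono_nat_of_lt_succ hlt
  rcases tendsto_atTop_of_monotone hmono.monotone with h | ⟨p, hp⟩
  · exact h
  · exfalso
    have hfix : H p = p := isFixedPt_of_tendsto_iterate hp R.continuous.continuousAt
    obtain ⟨δ, hδ, h⟩ := R.exists_expanding (p := p) (k := 0) (by simpa using hfix)
    obtain ⟨m, hm⟩ := (hp.eventually (Metric.ball_mem_nhds p hδ)).exists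
    have hlt' : H^[m] s < p := (hlt m).trans_le (hmono.monotone.ge_of_tendsto hp _)
    have h1 := h _ p hm (by simpa using hδ) (Or.inr le_rfl) hlt'
    have h2 := hlt m
    rw [Function.iterate_succ_apply'] at h2
    linarith

/-- If all images of `[a, b]` are no longer than the circle, then `H` maps no point `s` of `[a, b]`
to a point of `[a, b]` on the right of `s`: the orbit of `s` would tend to infinity, where the
displacement of `H` is large. Nor does it fix such a point `s < b`, as the orbits of points between
`s` and `b` would move away from `s`. -/
theorem not_overlap_right (R : WeaklyExpandingLift d H P V) {a b s : ℝ}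
    (hb : ∀ m, H^[m] b - H^[m] a ≤ 1) (hs : s ∈ Icc a b) (hHs : H s ∈ Icc a b)
    (h : s < H s ∨ H s = s ∧ s < b) : False := by
  have key : ∀ t c, t ∈ Icc a b → c ∈ Icc a b → ∀ m, H^[m] t - H^[m] c ≤ 1 := by
    intro t c ht hc m
    have h1 := (R.strictMono_iterate m).monotone ht.2
    have h2 := (R.strictMono_iterate m).monotone hc.1
    linarith [hb m]
  rcases h with h | ⟨h, hsb⟩
  · have ht := R.tendsto_iterate_atTop h
    obtain ⟨m, hm1, hm2⟩ := ((ht.eventually_ge_atTop 0).and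
      (ht.eventually_ge_atTop (4 - H 0))).exists
    have h1 := R.le_map_sub hm1
    have h2 := key _ _ hHs hs m
    rw [← Function.iterate_succ_apply, Function.iterate_succ_apply'] at h2
    linarith
  · obtain ⟨δ, hδ, he⟩ := R.exists_expanding (p := s) (k := 0) (by simpa using h)
    obtain ⟨t, ht1, ht2⟩ := exists_between (lt_min hsb (lt_add_of_pos_right s hδ))
    rw [lt_min_iff] at ht2
    have h1 := he s t (by simpa using hδ) (by rw [abs_lt]; constructor <;> linarith)
      (Or.inl le_rfl) ht1
    have ht := R.tendsto_iterate_atTop (s := t) (by linarith)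
    obtain ⟨m, hm⟩ := (ht.eventually_gt_atTop (s + 1)).exists
    have h2 := key t s ⟨hs.1.trans ht1.le, ht2.1.le⟩ hs m
    rw [Function.iterate_fixed h] at h2
    linarith

/-- If all images of `[a, b]` are no longer than the circle, then `H` maps no point of `[a, b]` into
`[a, b]`. -/
theorem not_overlap (R : WeaklyExpandingLift d H P V) {a b s : ℝ} (hab : a < b)
    (hb : ∀ m, H^[m] b - H^[m] a ≤ 1) (hs : s ∈ Icc a b) (hHs : H s ∈ Icc a b) : False := by
  by_cases h : s < H s ∨ H s = s ∧ s < b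
  · exact R.not_overlap_right hb hs hHs h
  · refine R.reflect_lift.not_overlap_right (a := -b) (b := -a) (s := -s) (fun m => ?_)
      ⟨neg_le_neg hs.2, neg_le_neg hs.1⟩ ?_ ?_
    · rw [reflect_iterate, reflect_iterate, neg_neg, neg_neg]
      linarith [hb m]
    · rw [reflect, neg_neg]
      exact ⟨neg_le_neg hHs.2, neg_le_neg hHs.1⟩
    · rw [reflect, neg_neg]
      push Not at h
      rcases h.1.lt_or_eq with h1 | h1
      · exact Or.inl (neg_lt_neg h1)
      · have := h.2 h1
        have := hs.2
        exact Or.inr ⟨by rw [h1], by linarith⟩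

/-- An interval all of whose images are shorter than the circle has images that are disjoint
modulo `1`. -/
theorem not_mem_image_of_wandering (R : WeaklyExpandingLift d H P V) {a b : ℝ} (hab : a < b)
    (hb : ∀ m, H^[m] b - H^[m] a ≤ 1) {i j : ℕ} (hij : i < j) {x : ℝ} {k : ℤ}
    (hi : x ∈ Icc (H^[i] a) (H^[i] b)) (hj : x + k ∈ Icc (H^[j] a) (H^[j] b)) : False := by
  have hr : 1 ≤ j - i := by omega
  -- `H^[j - i] - k` is again such a lift, and it maps the point `s` of the interval into it.
  have R' := (R.iterate hr).shift_lift 0 k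
  obtain ⟨s, hs⟩ := R.surjective_iterate (j - i) (x + k)
  have hG : shift H^[j - i] 0 k s = x := by simp [shift, hs]
  have hji : ∀ y, H^[j] y = H^[j - i] (H^[i] y) := fun y => by
    rw [← Function.iterate_add_apply, Nat.sub_add_cancel hij.le]
  rw [hji, hji, ← hs] at hj
  have hs' : s ∈ Icc (H^[i] a) (H^[i] b) :=
    ⟨(R.strictMono_iterate (j - i)).le_iff_le.1 hj.1,
      (R.strictMono_iterate (j - i)).le_iff_le.1 hj.2⟩
  refine R'.not_overlap (R.strictMono_iterate i hab) (fun m => ?_) hs' (hG ▸ hi)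
  obtain ⟨l, hl⟩ := (R.iterate hr).shift_iterate 0 k m
  rw [hl, hl, add_zero, add_zero, ← Function.iterate_mul, ← Function.iterate_add_apply,
    ← Function.iterate_add_apply]
  linarith [hb ((j - i) * m + i)]

/-- The grid point `c / N` of `ℝ / ℤ` that every interval longer than `1 / N` contains. -/
theorem exists_grid_mem {N : ℕ} (hN : 0 < N) (u : ℝ) :
    ∃ c : Fin N, ∃ q : ℤ, u ≤ (c : ℝ) / N + q ∧ (c : ℝ) / N + q < u + 1 / N := by
  have hN' : (0 : ℝ) < N := by exact_mod_cast hN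
  have hNz : (0 : ℤ) < N := by exact_mod_cast hN
  set k := ⌈u * N⌉ with hk
  have h0 := Int.emod_nonneg k hNz.ne'
  have h1 := Int.emod_lt_of_pos k hNz
  refine ⟨⟨(k % N).toNat, by omega⟩, k / N, ?_⟩
  have h2 : (((k % N).toNat : ℕ) : ℝ) = ((k % N : ℤ) : ℝ) := by
    have : (((k % N).toNat : ℕ) : ℤ) = k % N := Int.toNat_of_nonneg h0
    exact_mod_cast this
  have h3 : ((k % N : ℤ) : ℝ) / N + ((k / N : ℤ) : ℝ) = k / N := by
    have : ((k % N : ℤ) : ℝ) + N * ((k / N : ℤ) : ℝ) = k := by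
      exact_mod_cast Int.emod_add_mul_ediv k N
    field_simp
    linarith
  simp only [h2, h3]
  refine ⟨?_, ?_⟩
  · rw [le_div_iff₀ hN']
    exact Int.le_ceil _
  · rw [div_lt_iff₀ hN', add_mul, one_div, inv_mul_cancel₀ hN'.ne']
    exact Int.ceil_lt_add_one _

theorem frequently_exists_of_finite {ι α : Type*} [Finite ι] {l : Filter α} {p : α → ι → Prop}
    (h : ∃ᶠ n in l, ∃ c, p n c) : ∃ c, ∃ᶠ n in l, p n c := by
  by_contra hc
  push Not at hc
  refine h ?_
  filter_upwards [eventually_all.2 hc] with n hn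
  push Not
  exact hn

/-- The images of a nondegenerate interval cannot infinitely often have length between a fixed
positive number and `1`: two of them would meet modulo `1`. -/
theorem not_frequently_length_mem (R : WeaklyExpandingLift d H P V) {a b β : ℝ} (hab : a < b)
    (hβ : 0 < β) (h : ∃ᶠ n in atTop, β ≤ H^[n] b - H^[n] a ∧ H^[n] b - H^[n] a ≤ 1) : False := by
  have hb : ∀ m, H^[m] b - H^[m] a ≤ 1 := by
    intro m
    by_contra! hm
    obtain ⟨n, hn, h1, h2⟩ := frequently_atTop.1 h m
    linarith [R.iterate_sub_gt_one_of_le hn hm]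
  obtain ⟨N, hN⟩ := exists_nat_one_div_lt hβ
  have h1 : ∃ᶠ n in atTop, ∃ c : Fin (N + 1), ∃ q : ℤ,
      (c : ℝ) / (N + 1 : ℕ) + q ∈ Icc (H^[n] a) (H^[n] b) := by
    refine h.mono fun n hn => ?_
    obtain ⟨c, q, h1, h2⟩ := exists_grid_mem N.succ_pos (H^[n] a)
    refine ⟨c, q, h1, ?_⟩
    push_cast at *
    linarith [hn.1]
  obtain ⟨c, hc⟩ := frequently_exists_of_finite h1
  obtain ⟨i, q, hi⟩ := hc.exists
  obtain ⟨j, hj, q', hj'⟩ := frequently_atTop.1 hc (i + 1)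
  refine R.not_mem_image_of_wandering hab hb (show i < j by omega) hi (k := q' - q) ?_
  push_cast
  convert hj' using 1
  push_cast
  ring

/-- Intervals that are mapped by a high iterate, with bounded distortion, onto intervals of
definite length are short. If not, infinitely many of them would contain a common interval, whose
images would all be shorter than the circle but would not shrink. -/
theorem exists_forall_length_le (R : WeaklyExpandingLift d H P V) (K : ℝ) {η ε : ℝ} (hη : 0 < η)
    (hε : 0 < ε) : ∃ n₀ : ℕ, ∀ n ≥ n₀, ∀ u v : ℝ, u < v →
      ∑ j ∈ Finset.range n, (P (H^[j] v) - P (H^[j] u)) ≤ K →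
      η ≤ H^[n] v - H^[n] u → H^[n] v - H^[n] u ≤ 1 → v - u ≤ ε := by
  by_contra! hcon
  obtain ⟨N, hN⟩ := exists_nat_one_div_lt (half_pos hε)
  have hN' : (0 : ℝ) < (N + 1 : ℕ) := by positivity
  have h1 : ∃ᶠ n in atTop, ∃ c : Fin (N + 1),
      Real.exp (-K) * η * (1 / (N + 1 : ℕ)) ≤
        H^[n] ((c : ℝ) / (N + 1 : ℕ) + 1 / (N + 1 : ℕ)) - H^[n] ((c : ℝ) / (N + 1 : ℕ)) ∧
      H^[n] ((c : ℝ) / (N + 1 : ℕ) + 1 / (N + 1 : ℕ)) - H^[n] ((c : ℝ) / (N + 1 : ℕ)) ≤ 1 := by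
    refine frequently_atTop.2 fun n₀ => ?_
    obtain ⟨n, hn, u, v, huv, hK, h1, h2, h3⟩ := hcon n₀
    refine ⟨n, hn, ?_⟩
    obtain ⟨c, q, hc1, hc2⟩ := exists_grid_mem N.succ_pos u
    refine ⟨c, ?_⟩
    push_cast at *
    set x : ℝ := (c : ℝ) / (N + 1) with hx
    set y : ℝ := x + 1 / (N + 1) with hy
    have hpos : (0 : ℝ) < 1 / (N + 1) := by positivity
    have hxv : y + q ≤ v := by linarith
    have hxu : u ≤ x + q := hc1
    have hvu : v - u ≤ 1 := by
      by_contra! hvu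
      have := R.iterate_sub_gt_one_of_le (m := 0) (n := n) (Nat.zero_le n) hvu
      linarith
    obtain ⟨l, hl⟩ := R.exists_iterate_add_int n q
    have e : H^[n] y - H^[n] x = H^[n] (y + q) - H^[n] (x + q) := by rw [hl, hl]; ring
    rw [e]
    obtain ⟨s, hs, hse⟩ := R.exists_iterate_sub_eq n huv
    obtain ⟨t, ht, hte⟩ := R.exists_iterate_sub_eq n (show x + q < y + q by linarith)
    have hd := (R.abs_expo_sub_le n (u := u) (v := v) (Ioo_subset_Icc_self hs)
      (t := t) ⟨by linarith [ht.1], by linarith [ht.2]⟩).trans hK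
    have hexp : Real.exp (-K) * Real.exp (expo H n s) ≤ Real.exp (expo H n t) := by
      rw [← Real.exp_add]
      exact Real.exp_le_exp.2 (by linarith [(abs_le.1 hd).2])
    have hηs : η ≤ Real.exp (expo H n s) := by
      have := Real.exp_pos (expo H n s)
      nlinarith
    constructor
    · rw [hte, show y + (q : ℝ) - (x + q) = 1 / (N + 1) by rw [hy]; ring]
      refine mul_le_mul_of_nonneg_right (le_trans ?_ hexp) hpos.le
      exact mul_le_mul_of_nonneg_left hηs (Real.exp_pos _).le
    · have m := (R.strictMono_iterate n).monotone
      linarith [m hxv, m hxu]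
  obtain ⟨c, hc⟩ := frequently_exists_of_finite h1
  exact R.not_frequently_length_mem (lt_add_of_pos_right _ (by positivity)) (by positivity) hc

/-! ### Intervals that are disjoint modulo `1` -/

/-- The increments of `P` over intervals that are disjoint modulo `1` sum to at most `V`. -/
theorem sum_control_le (R : WeaklyExpandingLift d H P V) (s : Finset ℕ) (u v : ℕ → ℝ)
    (huv : ∀ j ∈ s, u j < v j) (hint : ∀ j ∈ s, ∀ k : ℤ, (k : ℝ) ∉ Ioo (u j) (v j))
    (hdisj : ∀ i ∈ s, ∀ j ∈ s, i < j → ∀ (k : ℤ) (x : ℝ), x ∈ Ioo (u i) (v i) →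
      x + k ∉ Ioo (u j) (v j)) :
    ∑ j ∈ s, (P (v j) - P (u j)) ≤ V := by
  set a : ℕ → ℝ := fun j => u j - ⌊u j⌋ with ha
  set b : ℕ → ℝ := fun j => v j - ⌊u j⌋ with hb
  have ha0 : ∀ j, 0 ≤ a j := fun j => by
    have := Int.floor_le (u j)
    simp only [ha]
    linarith
  have hb1 : ∀ j ∈ s, b j ≤ 1 := fun j hj => by
    by_contra! hlt
    refine hint j hj (⌊u j⌋ + 1) ⟨?_, ?_⟩
    · push_cast
      exact Int.lt_floor_add_one _
    · push_cast
      simp only [hb] at hlt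
      linarith
  have hP : ∀ j, P (v j) - P (u j) = P (b j) - P (a j) := fun j => by
    have h1 := R.control_add_int (v j) (-⌊u j⌋)
    have h2 := R.control_add_int (u j) (-⌊u j⌋)
    push_cast at h1 h2
    simp only [ha, hb, sub_eq_add_neg]
    rw [h1, h2]
    ring
  have hab : ∀ j ∈ s, a j < b j := fun j hj => by
    simp only [ha, hb]
    linarith [huv j hj]
  have hd : ∀ i ∈ s, ∀ j ∈ s, i < j → b i ≤ a j ∨ b j ≤ a i := by
    intro i hi j hj hij
    by_contra! hc
    obtain ⟨x, hx1, hx2⟩ := exists_between (show max (a i) (a j) < min (b i) (b j) from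
      max_lt (lt_min (hab i hi) hc.2) (lt_min hc.1 (hab j hj)))
    rw [max_lt_iff] at hx1
    rw [lt_min_iff] at hx2
    simp only [ha, hb] at hx1 hx2
    refine hdisj i hi j hj hij (⌊u j⌋ - ⌊u i⌋) (x + ⌊u i⌋) ⟨by linarith, by linarith⟩ ?_
    push_cast
    exact ⟨by linarith, by linarith⟩
  -- The intervals `(P (a j), P (b j))` are disjoint and contained in `[P 0, P 1]`: compare lengths.
  have hvol : ∀ j ∈ s, MeasureTheory.volume (Ioo (P (a j)) (P (b j))) =
      ENNReal.ofReal (P (b j) - P (a j)) := fun j _ => Real.volume_Ioo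
  have hpd : (s : Set ℕ).PairwiseDisjoint fun j => Ioo (P (a j)) (P (b j)) := by
    intro i hi j hj hij
    have key : ∀ i j, b i ≤ a j → Disjoint (Ioo (P (a i)) (P (b i))) (Ioo (P (a j)) (P (b j))) := by
      intro i j h
      rw [Set.disjoint_left]
      intro x hx hx'
      have := R.monotone h
      linarith [hx.2, hx'.1]
    have : b i ≤ a j ∨ b j ≤ a i := by
      rcases lt_or_gt_of_ne hij with h | h
      · exact hd i hi j hj h
      · exact (hd j hj i hi h).symm
    rcases this with h | h
    · exact key i j h
    · exact (key j i h).symm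
  have hle : ∑ j ∈ s, ENNReal.ofReal (P (b j) - P (a j)) ≤ ENNReal.ofReal V := by
    rw [← Finset.sum_congr rfl hvol,
      ← MeasureTheory.measure_biUnion_finset hpd fun j _ => measurableSet_Ioo]
    have hV : ENNReal.ofReal V = MeasureTheory.volume (Icc (P 0) (P 1)) := by
      have := R.control_add_one 0
      rw [zero_add] at this
      rw [Real.volume_Icc, this, add_sub_cancel_left]
    rw [hV]
    refine MeasureTheory.measure_mono (iUnion₂_subset fun j hj x hx => ⟨?_, ?_⟩)
    · exact (R.monotone (ha0 j)).trans hx.1.le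
    · exact hx.2.le.trans (R.monotone (hb1 j hj))
  rw [← ENNReal.ofReal_sum_of_nonneg fun j hj => sub_nonneg.2 (R.monotone (hab j hj).le)] at hle
  rw [Finset.sum_congr rfl fun j _ => hP j]
  exact (ENNReal.ofReal_le_ofReal_iff R.control_nonneg).1 hle

/-! ### First entries into nice intervals -/

theorem exists_iterate_int (R : WeaklyExpandingLift d H P V) (h0 : H 0 = 0) (n : ℕ) (k : ℤ) :
    ∃ l : ℤ, H^[n] k = l := by
  obtain ⟨l, hl⟩ := R.exists_iterate_add_int n k
  refine ⟨l, ?_⟩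
  have := hl 0
  rwa [Function.iterate_fixed h0, zero_add, zero_add] at this

/-- Let `(0, e)` be a nice interval: the orbit of `e` never enters it. If the orbit of `y` enters
`(0, e)` modulo `1` at time `n` for the first time, then the pullbacks of `(0, e)` along this orbit
are disjoint modulo `1`, so that `H^[n]` has distortion at most `V` on the first of them. -/
theorem sum_control_le_of_first_entry (R : WeaklyExpandingLift d H P V) (h0 : H 0 = 0) {e : ℝ}
    (he : e ≤ 1) (hnice : ∀ (r : ℕ) (k : ℤ), H^[r] e - k ∉ Ioo 0 e) {y : ℝ} {n : ℕ} {l : ℤ}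
    (hy : H^[n] y ∈ Ioo (l : ℝ) (l + e))
    (hfirst : ∀ k, 0 < k → k < n → ∀ l' : ℤ, H^[k] y - l' ∉ Ioo 0 e) {u v : ℝ} (huv : u < v)
    (hyuv : y ∈ Icc u v) (hu : l ≤ H^[n] u) (hv : H^[n] v ≤ l + e) :
    ∑ j ∈ Finset.range n, (P (H^[j] v) - P (H^[j] u)) ≤ V := by
  have hnoint : ∀ k : ℤ, (k : ℝ) ∉ Ioo (l : ℝ) (l + e) := fun k hk => by
    have h1 : l < k := by exact_mod_cast hk.1
    have h2 : (k : ℝ) < (l + 1 : ℤ) := by push_cast; linarith [hk.2]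
    have h3 : k < l + 1 := by exact_mod_cast h2
    omega
  have hcomp : ∀ {j}, j ≤ n → ∀ x, H^[n] x = H^[n - j] (H^[j] x) := fun {j} hj x => by
    rw [← Function.iterate_add_apply, Nat.sub_add_cancel hj]
  refine R.sum_control_le (Finset.range n) (fun j => H^[j] u) (fun j => H^[j] v)
    (fun j _ => R.strictMono_iterate j huv) (fun j hj k hk => ?_) ?_
  · have hj' := (Finset.mem_range.1 hj).le
    obtain ⟨l', hl'⟩ := R.exists_iterate_int h0 (n - j) k
    refine hnoint l' ?_
    rw [← hl']
    have h1 := R.strictMono_iterate (n - j) hk.1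
    have h2 := R.strictMono_iterate (n - j) hk.2
    rw [← hcomp hj'] at h1 h2
    exact ⟨by linarith, by linarith⟩
  · intro i _ j hj hij k x hx hxk
    have hj' := Finset.mem_range.1 hj
    obtain ⟨m, hm⟩ := R.exists_iterate_add_int (n - j) k
    have h1 := R.strictMono_iterate (n - j) hxk.1
    have h2 := R.strictMono_iterate (n - j) hxk.2
    rw [← hcomp hj'.le, hm] at h1 h2
    -- If the pullbacks at the times `i < j` met modulo `1`, then, mapping forward by `H^[n - j]`,
    -- the pullback at the time `K = n - j + i < n` would meet `(0, e)` modulo `1`.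
    set w := H^[n - j] x with hw
    have h3 := R.strictMono_iterate (n - j) hx.1
    have h4 := R.strictMono_iterate (n - j) hx.2
    rw [← Function.iterate_add_apply, ← hw] at h3 h4
    set K := n - j + i with hK
    have hKn : K < n := by omega
    have hcompK := fun z => hcomp hKn.le z
    have hyK := hfirst K (by omega) hKn (l - m)
    have hyl := (R.strictMono_iterate K).monotone hyuv.1
    have hyr := (R.strictMono_iterate K).monotone hyuv.2
    -- The pullback at time `K` meets `(0, e)` modulo `1` and is not contained in it, so it
    -- contains one of the endpoints.
    by_cases hc : H^[K] y ≤ (l - m : ℤ)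
    · obtain ⟨l', hl'⟩ := R.exists_iterate_int h0 (n - K) (l - m)
      refine hnoint l' ?_
      rw [← hl']
      have h5 := (R.strictMono_iterate (n - K)).monotone hc
      have h6 : ((l - m : ℤ) : ℝ) < H^[K] v := by push_cast; linarith
      have h7 := R.strictMono_iterate (n - K) h6
      rw [← hcompK] at h5 h7
      exact ⟨by linarith [hy.1], by linarith⟩
    · push Not at hc
      have hc2 : e + (l - m : ℤ) ≤ H^[K] y := by
        by_contra! hlt
        exact hyK ⟨by linarith, by linarith⟩
      obtain ⟨q, hq⟩ := R.exists_iterate_add_int (n - K) (l - m)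
      refine hnice (n - K) (l - q) ?_
      have h5 := (R.strictMono_iterate (n - K)).monotone hc2
      have h6 : H^[K] u < e + (l - m : ℤ) := by push_cast; linarith
      have h7 := R.strictMono_iterate (n - K) h6
      rw [← hcompK, hq] at h5 h7
      push_cast
      exact ⟨by linarith, by linarith [hy.2]⟩

/-- If from each time with property `Q` the derivative along the orbit of `x` gains a factor
`exp 1` until a later time with this property, then the derivatives of the iterates at `x` are
unbounded. -/
theorem exists_lt_expo {x : ℝ} (Q : ℕ → Prop) {i₀ : ℕ} (h0 : Q i₀)
    (h : ∀ i, Q i → ∃ n, Q (i + n) ∧ 1 ≤ expo H n (H^[i] x)) (B : ℝ) : ∃ n, B < expo H n x := by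
  have key : ∀ N : ℕ, ∃ i, Q i ∧ expo H i₀ x + N ≤ expo H i x := by
    intro N
    induction N with
    | zero => exact ⟨i₀, h0, by simp⟩
    | succ N ih =>
      obtain ⟨i, hi, hle⟩ := ih
      obtain ⟨n, hn, h1⟩ := h i hi
      refine ⟨i + n, hn, ?_⟩
      rw [expo_add]
      push_cast
      linarith
  obtain ⟨N, hN⟩ := exists_nat_gt (B - expo H i₀ x)
  obtain ⟨i, -, hi⟩ := key N
  exact ⟨i, by linarith⟩

/-! ### Orbits with bounded expansion stay away from periodic points -/

/-- The successive preimages `e m` of `1` that tend to the fixed point `0`. -/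
theorem exists_preimages (R : WeaklyExpandingLift d H P V) (h0 : H 0 = 0) :
    ∃ e : ℕ → ℝ, e 0 = 1 ∧ (∀ m, H (e (m + 1)) = e m) ∧ (∀ m, 0 < e m) ∧ StrictAnti e ∧
      ∀ δ > 0, ∃ m, e m < δ := by
  choose g hg using R.surjective
  set e : ℕ → ℝ := fun m => g^[m] 1 with he
  have hs : ∀ m, H (e (m + 1)) = e m := fun m => by
    simp only [he, Function.iterate_succ_apply']
    exact hg _
  have hpos : ∀ m, 0 < e m := by
    intro m
    induction m with
    | zero => simp [he]
    | succ m ih =>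
      rw [← hs, ← h0] at ih
      exact (R.strictMono.lt_iff_lt).1 ih
  have hanti : StrictAnti e := by
    refine strictAnti_nat_of_succ_lt fun m => ?_
    induction m with
    | zero =>
      have h1 : H 1 = d := by simpa [h0] using R.map_add_one 0
      have h2 : (2 : ℝ) ≤ d := by exact_mod_cast R.two_le
      refine (R.strictMono.lt_iff_lt).1 ?_
      rw [hs]
      simp only [he, Function.iterate_zero, id, h1]
      linarith
    | succ m ih =>
      rw [← hs, ← hs m] at ih
      exact (R.strictMono.lt_iff_lt).1 ih
  refine ⟨e, rfl, hs, hpos, hanti, fun δ hδ => ?_⟩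
  by_contra! hcon
  obtain ⟨δ₀, hδ₀, hexp⟩ := R.exists_expanding (p := 0) (k := 0) (by simpa using h0)
  set t := min δ (δ₀ / 2) with ht
  have ht0 : 0 < t := lt_min hδ (by linarith)
  have ht1 : t < δ₀ := (min_le_right _ _).trans_lt (by linarith)
  have h1 := hexp 0 t (by simpa using hδ₀) (by rw [sub_zero, abs_of_pos ht0]; exact ht1)
    (Or.inl le_rfl) ht0
  rw [h0] at h1
  obtain ⟨m, hm⟩ := ((R.tendsto_iterate_atTop (s := t) (by linarith)).eventually_gt_atTop 1).exists
  have h2 := (R.strictMono_iterate m).monotone ((min_le_left δ (δ₀ / 2)).trans (hcon m))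
  have h3 : ∀ m, H^[m] (e m) = 1 := by
    intro m
    induction m with
    | zero => simp [he]
    | succ m ih => rw [Function.iterate_succ_apply, hs, ih]
  rw [h3] at h2
  linarith

/-- An orbit that enters a small interval `(0, e m)` returns to definite size after following the
fixed point `0`. The pullback along this piece of orbit of the fundamental domain `[e 1, 1]`
has bounded distortion: the pullbacks up to the entry are disjoint, and those after the entry are
consecutive fundamental domains. Hence the orbit has expanded. -/
theorem eventually_not_mem_right_zero (R : WeaklyExpandingLift d H P V) (h0 : H 0 = 0) {x B : ℝ}
    (hB : ∀ n, expo H n x ≤ B) :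
    ∃ η > 0, ∀ᶠ i in atTop, ∀ k : ℤ, H^[i] x - k ∉ Ioo 0 η := by
  obtain ⟨e, e0, es, epos, eanti, etend⟩ := R.exists_preimages h0
  have ele : ∀ m, e m ≤ 1 := fun m => e0 ▸ eanti.antitone (Nat.zero_le m)
  have hη : 0 < 1 - e 1 := by
    have := eanti (show 0 < 1 by norm_num)
    linarith
  have eit : ∀ i m, H^[i] (e (m + i)) = e m := by
    intro i
    induction i with
    | zero => simp
    | succ i ih =>
      intro m
      rw [Function.iterate_succ_apply', show m + (i + 1) = (m + 1) + i by ring, ih, es]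
  obtain ⟨m, hm⟩ := R.exists_forall_length_le (2 * V) hη
    (mul_pos (Real.exp_pos (-(2 * V + 1))) hη)
  -- The orbit of `e m` runs through `e (m - 1), …, e 0 = 1` and then consists of integers.
  have hnice : ∀ (r : ℕ) (k : ℤ), H^[r] (e m) - k ∉ Ioo 0 (e m) := by
    intro r k hk
    rcases le_or_gt r m with h | h
    · have h1 : H^[r] (e m) = e (m - r) := by
        conv_lhs => rw [show m = (m - r) + r by omega]
        exact eit r _
      rw [h1] at hk
      have h2 : e m ≤ e (m - r) := eanti.antitone (by omega)
      have h3 := ele (m - r)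
      have h4 : (k : ℝ) < (1 : ℤ) := by push_cast; linarith [hk.1]
      have h5 : k < 1 := by exact_mod_cast h4
      have h6 : ((0 : ℤ) : ℝ) < k := by push_cast; linarith [hk.2]
      have h7 : 0 < k := by exact_mod_cast h6
      omega
    · have h1 : H^[m] (e m) = 1 := by simpa [e0] using eit m 0
      obtain ⟨l, hl⟩ := R.exists_iterate_int h0 (r - m) 1
      have h2 : H^[r] (e m) = l := by
        rw [show r = (r - m) + m by omega, Function.iterate_add_apply, h1]
        exact_mod_cast hl
      rw [h2] at hk
      have h4 : ((0 : ℤ) : ℝ) < (l - k : ℤ) := by push_cast; linarith [hk.1]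
      have h5 : ((l - k : ℤ) : ℝ) < (1 : ℤ) := by push_cast; linarith [hk.2, ele m]
      have h6 : 0 < l - k := by exact_mod_cast h4
      have h7 : l - k < 1 := by exact_mod_cast h5
      omega
  refine ⟨e m, epos m, ?_⟩
  by_contra hcon
  have hfreq : ∃ᶠ i in atTop, ∃ k : ℤ, H^[i] x - k ∈ Ioo 0 (e m) := by
    refine (not_eventually.1 hcon).mono fun i hi => ?_
    push Not at hi
    exact hi
  -- If the orbit enters `(0, e m)` infinitely often, it gains a factor `exp 1` from any time on.
  suffices hstep : ∀ i, ∃ n, 1 ≤ expo H n (H^[i] x) by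
    obtain ⟨n, hn⟩ := exists_lt_expo (H := H) (x := x) (fun _ => True) (i₀ := 0) trivial
      (fun i _ => (hstep i).imp fun _ h => ⟨trivial, h⟩) B
    exact absurd (hB n) (not_le.2 hn)
  intro i
  have hex : ∃ t, 0 < t ∧ ∃ k : ℤ, H^[t] (H^[i] x) - k ∈ Ioo 0 (e m) := by
    obtain ⟨j, hj, hj'⟩ := frequently_atTop.1 hfreq (i + 1)
    refine ⟨j - i, by omega, ?_⟩
    rwa [← Function.iterate_add_apply, Nat.sub_add_cancel (by omega)]
  classical
  set t := Nat.find hex with ht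
  obtain ⟨ht0, l, hl⟩ := Nat.find_spec hex
  rw [← ht] at hl ht0
  set y := H^[i] x with hy
  have hfirst : ∀ k, 0 < k → k < t → ∀ l' : ℤ, H^[k] y - l' ∉ Ioo 0 (e m) :=
    fun k hk hkt l' hl' => Nat.find_min hex hkt ⟨hk, l', hl'⟩
  -- At the first entry time `t` the orbit is in the fundamental domain `[e (M + 1), e M)`.
  have hexM : ∃ M, e M ≤ H^[t] y - l := by
    obtain ⟨M, hM⟩ := etend _ hl.1
    exact ⟨M, hM.le⟩
  obtain ⟨M, hM⟩ : ∃ M, Nat.find hexM = M + 1 := by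
    refine ⟨Nat.find hexM - 1, ?_⟩
    have : Nat.find hexM ≠ 0 := fun h => by
      have := Nat.find_spec hexM
      rw [h, e0] at this
      linarith [hl.2, ele m]
    omega
  have hM1 : e (M + 1) ≤ H^[t] y - l := hM ▸ Nat.find_spec hexM
  have hM2 : H^[t] y - l < e M := by
    have := Nat.find_min hexM (m := M) (by omega)
    linarith
  have hmM : m ≤ M := by
    by_contra! hlt
    have := eanti.antitone (show M + 1 ≤ m by omega)
    linarith [hl.2]
  obtain ⟨u, hu⟩ := R.surjective_iterate t (e (M + 1) + l)
  obtain ⟨v, hv⟩ := R.surjective_iterate t (e M + l)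
  have huv : u < v := by
    refine (R.strictMono_iterate t).lt_iff_lt.1 ?_
    rw [hu, hv]
    linarith [eanti (Nat.lt_succ_self M)]
  have hyuv : y ∈ Icc u v := by
    constructor
    · refine (R.strictMono_iterate t).le_iff_le.1 ?_
      rw [hu]
      linarith
    · refine (R.strictMono_iterate t).le_iff_le.1 ?_
      rw [hv]
      linarith
  have hsum1 := R.sum_control_le_of_first_entry h0 (ele m) hnice (y := y) (n := t) (l := l)
    ⟨by linarith [hl.1], by linarith [hl.2]⟩ hfirst huv hyuv (by rw [hu]; linarith [epos (M + 1)])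
    (by rw [hv]; linarith [eanti.antitone hmM])
  have hit : ∀ i w, H^[t + i] w = H^[i] (H^[t] w) := fun i w => by
    rw [add_comm, Function.iterate_add_apply]
  -- After the entry the images are consecutive intervals `[e (q + 1), e q]`: the sum telescopes.
  have hsum2 : ∑ j ∈ Finset.range M, (P (H^[t + j] v) - P (H^[t + j] u)) ≤ V := by
    have h1 : ∀ j ∈ Finset.range M, P (H^[t + j] v) - P (H^[t + j] u) =
        P (e (M + 1 - (j + 1))) - P (e (M + 1 - j)) := by
      intro j hj
      have hj' := Finset.mem_range.1 hj
      obtain ⟨q, hq⟩ := R.exists_iterate_add_int j l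
      rw [hit, hit, hu, hv, hq, hq, R.control_add_int, R.control_add_int]
      have h2 : H^[j] (e M) = e (M + 1 - (j + 1)) := by
        conv_lhs => rw [show M = (M + 1 - (j + 1)) + j by omega]
        exact eit j _
      have h3 : H^[j] (e (M + 1)) = e (M + 1 - j) := by
        conv_lhs => rw [show M + 1 = (M + 1 - j) + j by omega]
        exact eit j _
      rw [h2, h3]
      ring
    rw [Finset.sum_congr rfl h1, Finset.sum_range_sub fun j => P (e (M + 1 - j))]
    have h2 := R.monotone (ele (M + 1 - M))
    have h3 := R.monotone (epos (M + 1 - 0)).le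
    have h4 := R.control_add_one 0
    rw [zero_add] at h4
    linarith
  have hsum : ∑ j ∈ Finset.range (t + M), (P (H^[j] v) - P (H^[j] u)) ≤ 2 * V := by
    rw [Finset.sum_range_add]
    linarith
  have himg : H^[t + M] v - H^[t + M] u = 1 - e 1 := by
    obtain ⟨q, hq⟩ := R.exists_iterate_add_int M l
    rw [hit, hit, hu, hv, hq, hq]
    have h2 := eit M 0
    have h3 := eit M 1
    rw [zero_add, e0] at h2
    rw [add_comm 1 M] at h3
    rw [h2, h3]
    ring
  have hlen := hm (t + M) (by omega) u v huv hsum himg.ge (by rw [himg]; linarith [epos 1])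
  refine ⟨t + M, R.le_expo huv hyuv hsum ?_⟩
  rw [himg]
  calc Real.exp (2 * V + 1) * (v - u)
      ≤ Real.exp (2 * V + 1) * (Real.exp (-(2 * V + 1)) * (1 - e 1)) :=
        mul_le_mul_of_nonneg_left hlen (Real.exp_pos _).le
    _ = 1 - e 1 := by
        rw [← mul_assoc, ← Real.exp_add, add_neg_cancel, Real.exp_zero, one_mul]

/-- An orbit with bounded expansion stays away from the right side of a fixed point (modulo `1`). -/
theorem eventually_not_mem_right (R : WeaklyExpandingLift d H P V) {z : ℝ} {k : ℤ}
    (hz : H z = z + k) {x B : ℝ} (hB : ∀ n, expo H n x ≤ B) :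
    ∃ η > 0, ∀ᶠ i in atTop, ∀ l : ℤ, H^[i] x - z - l ∉ Ioo 0 η := by
  have hit : ∀ i, ∃ l : ℤ, (shift H z k)^[i] (x - z) = H^[i] x - z - l := fun i => by
    obtain ⟨l, hl⟩ := R.shift_iterate z k i
    exact ⟨l, by rw [hl, sub_add_cancel]⟩
  obtain ⟨η, hη, h⟩ := (R.shift_lift z k).eventually_not_mem_right_zero (x := x - z) (B := B)
    (by simp [shift, hz]) (fun n => by rw [R.expo_shift, sub_add_cancel]; exact hB n)
  refine ⟨η, hη, h.mono fun i hi l hl => ?_⟩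
  obtain ⟨m, hm⟩ := hit i
  refine hi (l - m) ?_
  rw [hm]
  push_cast
  rwa [sub_sub_sub_cancel_right]

theorem eventually_not_near_fixed (R : WeaklyExpandingLift d H P V) {z : ℝ} {k : ℤ}
    (hz : H z = z + k) {x B : ℝ} (hB : ∀ n, expo H n x ≤ B)
    (hx : ∀ (i : ℕ) (l : ℤ), H^[i] x ≠ z + l) :
    ∃ η > 0, ∀ᶠ i in atTop, ∀ l : ℤ, η ≤ |H^[i] x - z - l| := by
  obtain ⟨η₁, h₁, hr⟩ := R.eventually_not_mem_right hz hB
  obtain ⟨η₂, h₂, hl⟩ := R.reflect_lift.eventually_not_mem_right (z := -z) (k := -k) (x := -x)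
    (B := B) (by rw [reflect, neg_neg, hz]; push_cast; ring)
    (fun n => by rw [expo_reflect, neg_neg]; exact hB n)
  refine ⟨min η₁ η₂, lt_min h₁ h₂, ?_⟩
  filter_upwards [hr, hl] with i hi1 hi2 l
  by_contra! hlt
  rw [lt_min_iff] at hlt
  rcases lt_trichotomy (H^[i] x - z - l) 0 with h | h | h
  · refine hi2 (-l) ?_
    rw [reflect_iterate, neg_neg]
    rw [abs_of_neg h] at hlt
    push_cast
    exact ⟨by linarith, by linarith⟩
  · exact hx i l (by linarith)
  · rw [abs_of_pos h] at hlt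
    exact hi1 l ⟨h, hlt.1⟩

/-- An orbit along which the derivatives stay bounded stays away from every periodic orbit
that it does not hit. -/
theorem eventually_not_near_periodic (R : WeaklyExpandingLift d H P V) {r : ℕ} (hr : 1 ≤ r)
    {z : ℝ} {k : ℤ} (hz : H^[r] z = z + k) {x B : ℝ} (hB : ∀ n, expo H n x ≤ B)
    (hx : ∀ (i : ℕ) (l : ℤ), H^[i] x ≠ z + l) :
    ∃ η > 0, ∀ᶠ i in atTop, ∀ l : ℤ, η ≤ |H^[i] x - z - l| := by
  have hit : ∀ q i w, (H^[r])^[i] (H^[q] w) = H^[r * i + q] w := fun q i w => by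
    rw [← Function.iterate_mul, ← Function.iterate_add_apply]
  have key : ∀ q, ∃ η > 0, ∀ᶠ i in atTop, ∀ l : ℤ, η ≤ |H^[r * i + q] x - z - l| := by
    intro q
    obtain ⟨η, hη, h⟩ := (R.iterate hr).eventually_not_near_fixed hz (x := H^[q] x)
      (B := B - expo H q x)
      (fun n => by
        rw [R.expo_iterate]
        have := hB (q + r * n)
        rw [expo_add] at this
        linarith)
      (fun i l => by rw [hit]; exact hx _ l)
    exact ⟨η, hη, by simpa only [hit] using h⟩
  have key2 : ∀ Q, ∃ η > 0, ∃ N, ∀ q < Q, ∀ i ≥ N, ∀ l : ℤ, η ≤ |H^[r * i + q] x - z - l| := by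
    intro Q
    induction Q with
    | zero => exact ⟨1, one_pos, 0, by simp⟩
    | succ Q ih =>
      obtain ⟨η, hη, N, h⟩ := ih
      obtain ⟨η', hη', h'⟩ := key Q
      obtain ⟨N', h'⟩ := eventually_atTop.1 h'
      refine ⟨min η η', lt_min hη hη', max N N', fun q hq i hi l => ?_⟩
      rcases Nat.lt_succ_iff_lt_or_eq.1 hq with h1 | rfl
      · exact (min_le_left _ _).trans (h q h1 i ((le_max_left _ _).trans hi) l)
      · exact (min_le_right _ _).trans (h' i ((le_max_right _ _).trans hi) l)
  obtain ⟨η, hη, N, h⟩ := key2 r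
  refine ⟨η, hη, eventually_atTop.2 ⟨r * N, fun i hi l => ?_⟩⟩
  have := h (i % r) (Nat.mod_lt _ (by omega)) (i / r)
    ((Nat.le_div_iff_mul_le (by omega)).2 (by linarith [mul_comm r N])) l
  rwa [Nat.div_add_mod] at this

/-! ### Orbits with bounded expansion are preperiodic -/

theorem floor_eq_of_mem {x e : ℝ} {l : ℤ} (he : e ≤ 1) (h : x - l ∈ Ioo 0 e) : ⌊x⌋ = l := by
  rw [Int.floor_eq_iff]
  exact ⟨by linarith [h.1], by linarith [h.2]⟩

/-- Let `[a, e)` be the leftmost interval of level `m` that an orbit visits infinitely often, where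
the intervals of level `m` are cut out by the preimages of `0` under `H^[m]`. Then `(0, e)` is a
nice interval, since the orbit of `[a, e)` consists of intervals to the right of it. -/
theorem exists_nice_interval (R : WeaklyExpandingLift d H P V) (h0 : H 0 = 0) (x : ℝ) (m : ℕ) :
    ∃ a e : ℝ, e ≤ 1 ∧ H^[m] e - H^[m] a = 1 ∧
      (∀ (r : ℕ) (k : ℤ), H^[r] e - k ∉ Ioo 0 e) ∧
      (∀ᶠ i in atTop, a ≤ Int.fract (H^[i] x)) ∧ ∃ᶠ i in atTop, Int.fract (H^[i] x) < e := by
  set y : ℕ → ℝ := fun i => Int.fract (H^[i] x) with hy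
  have hmono := R.strictMono_iterate m
  have hm0 : H^[m] 0 = 0 := Function.iterate_fixed h0 m
  have hm1 : H^[m] 1 = (d ^ m : ℕ) := by
    have := R.iterate_add_int m 0 1
    rw [hm0] at this
    simpa using this
  have hy0 : ∀ i, 0 ≤ H^[m] (y i) := fun i => hm0 ▸ hmono.monotone (Int.fract_nonneg _)
  have hy1 : ∀ i, H^[m] (y i) < (d ^ m : ℕ) := fun i => hm1 ▸ hmono (Int.fract_lt_one _)
  -- The interval of level `m` with index `j` is the set where `H^[m]` has integral part `j`.
  have hex : ∃ j : ℕ, ∃ᶠ i in atTop, ⌊H^[m] (y i)⌋₊ = j := by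
    have h1 : ∃ᶠ i : ℕ in atTop, ∃ c : Fin (d ^ m), ⌊H^[m] (y i)⌋₊ = c :=
      Frequently.of_forall fun i => ⟨⟨⌊H^[m] (y i)⌋₊, (Nat.floor_lt (hy0 i)).2 (hy1 i)⟩, rfl⟩
    obtain ⟨c, hc⟩ := frequently_exists_of_finite h1
    exact ⟨c, hc⟩
  classical
  set j := Nat.find hex with hj
  have hjf : ∃ᶠ i in atTop, ⌊H^[m] (y i)⌋₊ = j := Nat.find_spec hex
  have hjd : j < d ^ m := by
    obtain ⟨i, hi⟩ := hjf.exists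
    rw [← hi]
    exact (Nat.floor_lt (hy0 i)).2 (hy1 i)
  have hge : ∀ᶠ i in atTop, j ≤ ⌊H^[m] (y i)⌋₊ := by
    by_contra hcon
    have h1 : ∃ᶠ i in atTop, ∃ c : Fin j, ⌊H^[m] (y i)⌋₊ = c :=
      (not_eventually.1 hcon).mono fun i hi => ⟨⟨_, not_le.1 hi⟩, rfl⟩
    obtain ⟨c, hc⟩ := frequently_exists_of_finite h1
    exact Nat.find_min hex c.2 hc
  obtain ⟨a, ha⟩ := R.surjective_iterate m j
  obtain ⟨e, he⟩ := R.surjective_iterate m (j + 1)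
  have hae : ∀ i, ⌊H^[m] (y i)⌋₊ = j ↔ a ≤ y i ∧ y i < e := fun i => by
    rw [Nat.floor_eq_iff (hy0 i), ← he, ← ha, hmono.le_iff_le, hmono.lt_iff_lt]
  have he1 : e ≤ 1 := by
    rw [← hmono.le_iff_le, he, hm1]
    exact_mod_cast hjd
  have hage : ∀ᶠ i in atTop, a ≤ y i := hge.mono fun i hi => by
    rw [← hmono.le_iff_le, ha]
    exact (Nat.le_floor_iff (hy0 i)).1 hi
  refine ⟨a, e, he1, by rw [he, ha]; ring, fun r k hk => ?_, hage,
    hjf.mono fun i hi => ((hae i).1 hi).2⟩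
  rcases lt_or_ge r m with hr | hr
  · -- An image of `[a, e)` whose right endpoint is in `(0, e)` would lie to the left of `[a, e)`.
    refine hjf ?_
    have hshift : ∀ᶠ i in atTop, j ≤ ⌊H^[m] (y (i + r))⌋₊ :=
      (tendsto_add_atTop_nat r).eventually hge
    filter_upwards [hshift] with i hi hij
    obtain ⟨h1, h2⟩ := (hae i).1 hij
    have hmr : ∀ w, H^[m] w = H^[m - r] (H^[r] w) := fun w => by
      rw [← Function.iterate_add_apply, Nat.sub_add_cancel hr.le]
    obtain ⟨q, hq⟩ := R.exists_iterate_add_int (m - r) (-k)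
    have hq' : ∀ w, H^[m - r] (w - k) = H^[m - r] w + q := fun w => by
      have := hq w
      push_cast at this
      rw [sub_eq_add_neg, this]
    -- `w` is the image of the orbit point under `H^[r]`, moved next to `(0, e)`.
    set w := H^[r] (y i) - k with hw
    have hwe : w < H^[r] e - k := by
      have := R.strictMono_iterate r h2
      linarith
    have hw0 : 0 ≤ w := by
      have h3 : ((j + q : ℤ) : ℝ) ≤ H^[m - r] w := by
        rw [hw, hq', ← hmr]
        push_cast
        rw [← ha]
        linarith [hmono.monotone h1]
      have h4 : H^[m - r] 0 < ((j + q + 1 : ℤ) : ℝ) := by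
        have := R.strictMono_iterate (m - r) hk.1
        rw [hq', ← hmr, he] at this
        push_cast
        linarith
      rw [Function.iterate_fixed h0] at h4
      have h5 : 0 < (j : ℤ) + q + 1 := by exact_mod_cast h4
      have h6 : (0 : ℝ) ≤ ((j + q : ℤ) : ℝ) := by exact_mod_cast (by omega : (0 : ℤ) ≤ j + q)
      rw [← (R.strictMono_iterate (m - r)).le_iff_le, Function.iterate_fixed h0]
      linarith
    have hwy : w = y (i + r) := by
      obtain ⟨c, hc⟩ := R.exists_iterate_add_int r ⌊H^[i] x⌋
      have h3 : H^[i + r] x = w + ((k + c : ℤ) : ℝ) := by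
        have h4 := hc (y i)
        simp only [hy] at h4
        rw [Int.fract_add_floor] at h4
        rw [add_comm i r, Function.iterate_add_apply, h4, hw]
        push_cast
        simp only [hy]
        ring
      simp only [hy]
      rw [h3, Int.fract_add_intCast, Int.fract_eq_self.2 ⟨hw0, by linarith [hk.2]⟩]
    have h7 : H^[m] (H^[r] e - k) < H^[m] e := hmono hk.2
    have hint : ∃ l : ℤ, H^[m] (H^[r] e - k) = l := by
      obtain ⟨l, hl⟩ := R.exists_iterate_int h0 r (j + 1 + q)
      refine ⟨l, ?_⟩
      rw [show m = r + (m - r) by omega, Function.iterate_add_apply, hq', ← hmr, he]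
      rw [← hl]
      push_cast
      ring_nf
    obtain ⟨l, hl⟩ := hint
    rw [hl, he] at h7
    have h8 : l < j + 1 := by exact_mod_cast h7
    have h9 := hmono hwe
    rw [hl, hwy] at h9
    have h10 : (j : ℝ) ≤ H^[m] (y (i + r)) := (Nat.le_floor_iff (hy0 _)).1 hi
    have h11 : ((j : ℤ) : ℝ) < l := by push_cast; linarith
    have h12 : (j : ℤ) < l := by exact_mod_cast h11
    omega
  · obtain ⟨l, hl⟩ := R.exists_iterate_int h0 (r - m) (j + 1)
    have h1 : H^[r] e = l := by
      rw [show r = (r - m) + m by omega, Function.iterate_add_apply, he, ← hl]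
      push_cast
      rfl
    rw [h1] at hk
    have h4 : ((0 : ℤ) : ℝ) < (l - k : ℤ) := by push_cast; linarith [hk.1]
    have h5 : ((l - k : ℤ) : ℝ) < (1 : ℤ) := by push_cast; linarith [hk.2]
    have h6 : 0 < l - k := by exact_mod_cast h4
    have h7 : l - k < 1 := by exact_mod_cast h5
    omega

/-- Long first returns to `(0, e)` expand, where `e` is not small. Hence the leftmost intervals of
every level have infinitely many short returns. -/
theorem exists_short_return (R : WeaklyExpandingLift d H P V) (h0 : H 0 = 0) {x B η : ℝ}
    (hB : ∀ n, expo H n x ≤ B) (hη : 0 < η) (hx : ∀ i, η ≤ Int.fract (H^[i] x)) :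
    ∃ n₀ : ℕ, ∀ m, ∃ i ≥ m, ∃ r, 1 ≤ r ∧ r < n₀ ∧
      |H^[m] (Int.fract (H^[i] x)) - H^[m] (Int.fract (H^[i + r] x))| ≤ 1 := by
  obtain ⟨n₀, hn₀⟩ := R.exists_forall_length_le V hη (mul_pos (Real.exp_pos (-(V + 1))) hη)
  refine ⟨n₀, fun m => ?_⟩
  obtain ⟨a, e, he1, hea, hnice, hage, hfreq⟩ := R.exists_nice_interval h0 x m
  have hmono := (R.strictMono_iterate m).monotone
  by_contra! hcon
  obtain ⟨N, hN⟩ := eventually_atTop.1 hage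
  obtain ⟨i₀, hi₀, hi₀e⟩ := frequently_atTop.1 hfreq (max N m)
  -- Suppose that all returns from late visits to the leftmost interval of level `m` are long.
  suffices hstep : ∀ i, (max N m ≤ i ∧ Int.fract (H^[i] x) < e) →
      ∃ n, (max N m ≤ i + n ∧ Int.fract (H^[i + n] x) < e) ∧ 1 ≤ expo H n (H^[i] x) by
    obtain ⟨n, hn⟩ := exists_lt_expo (H := H) (x := x) _ ⟨hi₀, hi₀e⟩ hstep B
    exact absurd (hB n) (not_le.2 hn)
  rintro i ⟨hi, hie⟩
  have hex : ∃ n, 0 < n ∧ Int.fract (H^[i + n] x) < e := by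
    obtain ⟨j, hj, hj'⟩ := frequently_atTop.1 hfreq (i + 1)
    refine ⟨j - i, by omega, ?_⟩
    rwa [show i + (j - i) = j by omega]
  classical
  set n := Nat.find hex with hn
  obtain ⟨hn0, hne⟩ := Nat.find_spec hex
  rw [← hn] at hn0 hne
  refine ⟨n, ⟨by omega, hne⟩, ?_⟩
  have hNi : N ≤ i := (le_max_left _ _).trans hi
  have hnn : n₀ ≤ n := by
    by_contra! hlt
    have h1 := hcon i ((le_max_right _ _).trans hi) n hn0 hlt
    have h2 := hN i hNi
    have h3 := hN (i + n) (by omega)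
    refine absurd h1 (not_lt.2 (abs_le.2 ⟨?_, ?_⟩))
    · linarith [hmono h2, hmono hne.le]
    · linarith [hmono h3, hmono hie.le]
  have hit : ∀ k, H^[k] (H^[i] x) = H^[i + k] x := fun k => by
    rw [← Function.iterate_add_apply, add_comm]
  set l := ⌊H^[i + n] x⌋ with hl
  have hfl : Int.fract (H^[i + n] x) = H^[i + n] x - l := rfl
  have hηn := hx (i + n)
  obtain ⟨u, hu⟩ := R.surjective_iterate n l
  obtain ⟨v, hv⟩ := R.surjective_iterate n (l + e)
  have heη : η < e := (hx i).trans_lt hie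
  have huv : u < v := by
    refine (R.strictMono_iterate n).lt_iff_lt.1 ?_
    rw [hu, hv]
    linarith
  have hyuv : H^[i] x ∈ Icc u v := by
    constructor
    · refine (R.strictMono_iterate n).le_iff_le.1 ?_
      rw [hu, hit]
      linarith
    · refine (R.strictMono_iterate n).le_iff_le.1 ?_
      rw [hv, hit]
      linarith
  -- By leftmostness, late visits to `(0, e)` are visits to `[a, e)`: the first return to the latter
  -- is the first entry into the former.
  have hsum := R.sum_control_le_of_first_entry h0 he1 hnice (y := H^[i] x) (n := n) (l := l)
    (by rw [hit]; exact ⟨by linarith, by linarith⟩) (fun k hk hkn l' hl' => by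
      refine Nat.find_min hex hkn ⟨hk, ?_⟩
      have h1 := floor_eq_of_mem he1 hl'
      rw [hit] at h1 hl'
      rw [Int.fract, h1]
      exact hl'.2) huv hyuv hu.ge hv.le
  have himg : H^[n] v - H^[n] u = e := by rw [hu, hv]; ring
  have hlen := hn₀ n hnn u v huv hsum (by rw [himg]; exact heη.le) (by rw [himg]; exact he1)
  refine R.le_expo huv hyuv hsum ?_
  rw [himg]
  calc Real.exp (V + 1) * (v - u)
      ≤ Real.exp (V + 1) * (Real.exp (-(V + 1)) * η) :=
        mul_le_mul_of_nonneg_left hlen (Real.exp_pos _).le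
    _ = η := by rw [← mul_assoc, ← Real.exp_add, add_neg_cancel, Real.exp_zero, one_mul]
    _ ≤ e := heη.le

/-- The short returns of the leftmost intervals accumulate at a periodic point. -/
theorem exists_periodic_accumulation (R : WeaklyExpandingLift d H P V) (h0 : H 0 = 0) {x B η : ℝ}
    (hB : ∀ n, expo H n x ≤ B) (hη : 0 < η) (hx : ∀ i, η ≤ Int.fract (H^[i] x)) :
    ∃ r, 1 ≤ r ∧ ∃ (k : ℤ) (z : ℝ), H^[r] z = z + k ∧
      ∀ δ > 0, ∃ᶠ i in atTop, ∃ l : ℤ, |H^[i] x - z - l| < δ := by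
  obtain ⟨n₀, h⟩ := R.exists_short_return h0 hB hη hx
  set y : ℕ → ℝ := fun i => Int.fract (H^[i] x) with hy
  have h1 : ∃ᶠ m in atTop, ∃ r : Fin n₀, 1 ≤ (r : ℕ) ∧ ∃ i ≥ m,
      |H^[m] (y i) - H^[m] (y (i + r))| ≤ 1 := Frequently.of_forall fun m => by
    obtain ⟨i, hi, r, hr1, hr2, hr3⟩ := h m
    exact ⟨⟨r, hr2⟩, hr1, i, hi, hr3⟩
  obtain ⟨⟨r, hrn⟩, hr⟩ := frequently_exists_of_finite h1
  simp only at hr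
  have hr1 : 1 ≤ r := by
    obtain ⟨m, hm, -⟩ := hr.exists
    exact hm
  have hle : ∀ {m n : ℕ} {s t : ℝ}, m ≤ n → |H^[n] s - H^[n] t| ≤ 1 → |H^[m] s - H^[m] t| ≤ 1 := by
    intro m n s t hmn hst
    rw [abs_le] at hst ⊢
    constructor
    · by_contra! hlt
      linarith [R.iterate_sub_gt_one_of_le (x := s) (y := t) hmn (by linarith)]
    · by_contra! hlt
      linarith [R.iterate_sub_gt_one_of_le (x := t) (y := s) hmn (by linarith)]
  -- By the pigeonhole principle a single return time `r` serves all levels.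
  have h2 : ∀ m, ∃ i ≥ m, |H^[m] (y i) - H^[m] (y (i + r))| ≤ 1 := by
    intro m
    obtain ⟨n, hn, -, i, hi, hi'⟩ := frequently_atTop.1 hr m
    exact ⟨i, by omega, hle hn hi'⟩
  choose i hi hi' using h2
  have hyI : ∀ j, y j ∈ Icc (0 : ℝ) 1 := fun j => ⟨Int.fract_nonneg _, (Int.fract_lt_one _).le⟩
  obtain ⟨⟨α, β⟩, -, φ, hφ, hlim⟩ := ((isCompact_Icc (a := (0 : ℝ)) (b := 1)).prod
    (isCompact_Icc (a := (0 : ℝ)) (b := 1))).tendsto_subseq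
    (x := fun m => (y (i m), y (i m + r))) fun m => ⟨hyI _, hyI _⟩
  have hα : Tendsto (fun m => y (i (φ m))) atTop (𝓝 α) := (continuous_fst.tendsto _).comp hlim
  have hβ : Tendsto (fun m => y (i (φ m) + r)) atTop (𝓝 β) := (continuous_snd.tendsto _).comp hlim
  have hφi : ∀ m, m ≤ i (φ m) := fun m => (hφ.id_le m).trans (hi _)
  obtain ⟨k, hk⟩ : ∃ k : ℤ, (k : ℝ) = H^[r] α - β := by
    have h3 : Tendsto (fun m => H^[r] (y (i (φ m))) - y (i (φ m) + r)) atTop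
        (𝓝 (H^[r] α - β)) := (((R.continuous_iterate r).tendsto α).comp hα).sub hβ
    refine Int.isClosedEmbedding_coe_real.isClosed_range.mem_of_tendsto h3
      (Eventually.of_forall fun m => ?_)
    obtain ⟨l, hl⟩ := R.exists_iterate_add_int r (-⌊H^[i (φ m)] x⌋)
    refine ⟨l + ⌊H^[i (φ m) + r] x⌋, ?_⟩
    have h4 := hl (H^[i (φ m)] x)
    push_cast at h4
    rw [← sub_eq_add_neg] at h4
    simp only [hy, Int.fract]
    rw [h4, add_comm (i (φ m)) r, Function.iterate_add_apply]
    push_cast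
    ring
  have hαβ : ∀ m, |H^[m] α - H^[m] β| ≤ 1 := by
    intro m
    have hc := R.continuous_iterate m
    refine le_of_tendsto ((((hc.tendsto α).comp hα).sub ((hc.tendsto β).comp hβ)).abs) ?_
    filter_upwards [eventually_ge_atTop m] with n hn
    exact hle (hn.trans (hφ.id_le n)) (hi' (φ n))
  -- Otherwise the images of the interval between the limits `α` and `β` would be no longer than the
  -- circle, and `H^[r]` would map its endpoint `α` to its endpoint `β` modulo `1`.
  have heq : α = β := by
    by_contra hne
    have hmn : min α β < max α β := min_lt_max.2 hne
    have hmin : ∀ m, H^[m] (min α β) = min (H^[m] α) (H^[m] β) := fun m =>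
      (R.strictMono_iterate m).monotone.map_min
    have hmax : ∀ m, H^[m] (max α β) = max (H^[m] α) (H^[m] β) := fun m =>
      (R.strictMono_iterate m).monotone.map_max
    refine R.not_mem_image_of_wandering hmn (fun m => ?_) (i := 0) (j := r) (by omega)
      (x := β) (k := k) ⟨min_le_right _ _, le_max_right _ _⟩ ?_
    · rw [hmin, hmax, max_sub_min_eq_abs']
      exact hαβ m
    · rw [hk, hmin, hmax, add_sub_cancel]
      exact ⟨min_le_left _ _, le_max_left _ _⟩
  refine ⟨r, hr1, k, α, by rw [hk, ← heq]; ring, fun δ hδ => ?_⟩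
  refine frequently_atTop.2 fun N => ?_
  obtain ⟨m, hm1, hm2⟩ := ((hα.eventually (Metric.ball_mem_nhds α hδ)).and
    (eventually_ge_atTop N)).exists
  refine ⟨i (φ m), hm2.trans (hφi m), ⌊H^[i (φ m)] x⌋, ?_⟩
  have : |y (i (φ m)) - α| < δ := hm1
  simp only [hy, Int.fract] at this
  rwa [sub_right_comm]

theorem exists_fixed (R : WeaklyExpandingLift d H P V) : ∃ z, H z = z := by
  have h1 := R.le_map_sub (x := |H 0| + 2) (by positivity)
  have h2 := R.reflect_lift.le_map_sub (x := |H 0| + 2) (by positivity)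
  simp only [reflect, neg_zero] at h2
  have hc : Continuous fun x => H x - x := R.continuous.sub continuous_id
  obtain ⟨z, hz⟩ := mem_range_of_exists_le_of_exists_ge hc (c := 0)
    ⟨-(|H 0| + 2), by linarith [neg_abs_le (H 0), le_abs_self (H 0)]⟩
    ⟨|H 0| + 2, by linarith [neg_abs_le (H 0), le_abs_self (H 0)]⟩
  exact ⟨z, by linarith [hz]⟩

theorem expo_nonneg_of_periodic (R : WeaklyExpandingLift d H P V) {r : ℕ} (hr : 1 ≤ r) {k : ℤ}
    {p : ℝ} (hp : H^[r] p = p + k) : 0 ≤ expo H r p := by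
  have h1 : Tendsto (expo H r) (𝓝[≠] p) (𝓝 (expo H r p)) :=
    ((R.continuous_expo r).tendsto p).mono_left nhdsWithin_le_nhds
  exact ge_of_tendsto h1 ((R.eventually_pos r hr k p hp).mono fun x hx => hx.le)

theorem periodic_mul (R : WeaklyExpandingLift d H P V) {r : ℕ} {k : ℤ} {p : ℝ}
    (hp : H^[r] p = p + k) (q : ℕ) :
    (∃ l : ℤ, H^[r * q] p = p + l) ∧ expo H (r * q) p = q * expo H r p := by
  induction q with
  | zero => exact ⟨⟨0, by simp⟩, by simp [expo_zero]⟩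
  | succ q ih =>
    obtain ⟨⟨l, hl⟩, he⟩ := ih
    rw [Nat.mul_succ]
    constructor
    · obtain ⟨l', hl'⟩ := R.exists_iterate_add_int r l
      refine ⟨k + l', ?_⟩
      rw [add_comm (r * q) r, Function.iterate_add_apply, hl, hl', hp]
      push_cast
      ring
    · rw [expo_add, hl, R.expo_add_int, he]
      push_cast
      ring

/-- The lifts of the parabolic periodic points. -/
def parabolic (H : ℝ → ℝ) : Set ℝ :=
  {p | ∃ r, 1 ≤ r ∧ ∃ k : ℤ, H^[r] p = p + k ∧ expo H r p = 0}

/-- An orbit along which the derivatives of the iterates stay bounded ends in a parabolic periodic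
orbit. -/
theorem exists_parabolic_of_bounded (R : WeaklyExpandingLift d H P V) {x B : ℝ}
    (hB : ∀ n, expo H n x ≤ B) : ∃ i, H^[i] x ∈ parabolic H := by
  by_cases hpre : ∃ i r, 1 ≤ r ∧ ∃ k : ℤ, H^[r] (H^[i] x) = H^[i] x + k
  · obtain ⟨i, r, hr, k, hk⟩ := hpre
    refine ⟨i, r, hr, k, hk, le_antisymm ?_ (R.expo_nonneg_of_periodic hr hk)⟩
    by_contra! hpos
    obtain ⟨q, hq⟩ := exists_nat_gt ((B - expo H i x) / expo H r (H^[i] x))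
    rw [div_lt_iff₀ hpos, ← (R.periodic_mul hk q).2] at hq
    have := hB (i + r * q)
    rw [expo_add] at this
    linarith
  · exfalso
    push Not at hpre
    have hit : ∀ {r : ℕ} {z : ℝ} {k : ℤ}, 1 ≤ r → H^[r] z = z + k →
        ∀ (i : ℕ) (l : ℤ), H^[i] x ≠ z + l := by
      intro r z k hr hz i l hl
      obtain ⟨l', hl'⟩ := R.exists_iterate_add_int r l
      refine hpre i r hr (k + l' - l) ?_
      rw [hl, hl', hz]
      push_cast
      ring
    obtain ⟨z₀, hz₀⟩ := R.exists_fixed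
    have hz₀' : H z₀ = z₀ + (0 : ℤ) := by simpa using hz₀
    have hB' : ∀ N n, expo H n (H^[N] x) ≤ B - expo H N x := fun N n => by
      have := hB (N + n)
      rw [expo_add] at this
      linarith
    obtain ⟨η, hη, hev⟩ := R.eventually_not_near_fixed hz₀' hB (hit le_rfl hz₀')
    obtain ⟨N, hN⟩ := eventually_atTop.1 hev
    have hsh : ∀ i, ∃ l : ℤ, (shift H z₀ 0)^[i] (H^[N] x - z₀) = H^[i + N] x - z₀ - l := fun i => by
      obtain ⟨l, hl⟩ := R.shift_iterate z₀ 0 i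
      exact ⟨l, by rw [hl, sub_add_cancel, Function.iterate_add_apply]⟩
    obtain ⟨r, hr, k, z, hz, hacc⟩ := (R.shift_lift z₀ 0).exists_periodic_accumulation
      (by simp [shift, hz₀]) (x := H^[N] x - z₀) (B := B - expo H N x)
      (fun n => by rw [R.expo_shift, sub_add_cancel]; exact hB' N n) hη (fun i => by
        obtain ⟨l, hl⟩ := hsh i
        rw [hl]
        have := hN (i + N) (by omega) (l + ⌊H^[i + N] x - z₀ - l⌋)
        push_cast at this
        rwa [← sub_sub, Int.self_sub_floor, abs_of_nonneg (Int.fract_nonneg _)] at this)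
    obtain ⟨m, hm⟩ := R.shift_iterate z₀ 0 r
    have hz' : H^[r] (z + z₀) = (z + z₀) + (k + m : ℤ) := by
      rw [hm] at hz
      push_cast
      linarith
    obtain ⟨δ, hδ, hfar⟩ := R.eventually_not_near_periodic hr hz' hB (hit hr hz')
    have hfar' := (tendsto_add_atTop_nat N).eventually hfar
    obtain ⟨i, ⟨l, hl⟩, hi⟩ := ((hacc δ hδ).and_eventually hfar').exists
    obtain ⟨l', hl'⟩ := hsh i
    have h1 := hi (l + l')
    rw [hl'] at hl
    push_cast at h1
    rw [show H^[i + N] x - (z + z₀) - (l + l') = H^[i + N] x - z₀ - l' - z - l by ring] at h1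
    linarith

/-! ### Expansion along the exit from a periodic point -/

/-- The images of the fundamental domain `[x, H x]` are consecutive, so that the distortion of the
iterates on it is bounded; it is the shorter the closer `x` is to the fixed point. -/
theorem exists_exit_right_zero (R : WeaklyExpandingLift d H P V) (h0 : H 0 = 0) {δ : ℝ}
    (hδ : 0 < δ) (L : ℝ) : ∃ δ' > 0, ∀ x ∈ Ioo 0 δ', ∃ t, L ≤ expo H t x ∧
      ∀ i < t, H^[i] x ∈ Ioo 0 δ := by
  obtain ⟨δ₀, hδ₀, hexp⟩ := R.exists_expanding (p := 0) (k := 0) (by simpa using h0)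
  have hup : ∀ y, 0 < y → y < δ₀ → y < H y := fun y hy hy' => by
    have := hexp 0 y (by simpa using hδ₀) (by rwa [sub_zero, abs_of_pos hy]) (Or.inl le_rfl) hy
    rw [h0] at this
    linarith
  -- Follow the orbit until it passes `b`, where the displacement of `H` has a positive lower bound.
  set b := min δ (δ₀ / 2) with hb
  have hb0 : 0 < b := lt_min hδ (by linarith)
  have hbδ : b ≤ δ := min_le_left _ _
  have hbδ₀ : b < δ₀ := (min_le_right _ _).trans_lt (by linarith)
  have hbH := hup b hb0 hbδ₀
  obtain ⟨m, hm, hmin⟩ := (isCompact_Icc (a := b) (b := H b)).exists_isMinOn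
    ⟨b, left_mem_Icc.2 hbH.le⟩ (R.continuous.sub continuous_id).continuousOn
  have hμ : 0 < H m - m := by
    have h1 : H b ≤ H m := R.strictMono.monotone hm.1
    by_contra! hle
    have h2 : H b = m := by linarith [hm.2]
    have h3 : H m = H b := by linarith
    have := R.strictMono.injective h3
    linarith
  set K := P (H b) - P 0 with hK
  have hcont : Tendsto (fun x => H x - x) (𝓝 0) (𝓝 0) := by
    have hc : Continuous fun x => H x - x := R.continuous.sub continuous_id
    have := hc.tendsto 0
    simpa [h0] using this
  have hsmall := hcont.eventually (Metric.ball_mem_nhds 0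
    (mul_pos (Real.exp_pos (-(K + L))) hμ))
  obtain ⟨δ₁, hδ₁, hδ₁'⟩ := Metric.eventually_nhds_iff.1 hsmall
  refine ⟨min δ₁ b, lt_min hδ₁ hb0, fun x hx => ?_⟩
  have hxb : x < b := hx.2.trans_le (min_le_right _ _)
  have hxH := hup x hx.1 (hxb.trans hbδ₀)
  have hex : ∃ t, b ≤ H^[t] x := ((R.tendsto_iterate_atTop hxH).eventually_ge_atTop b).exists
  classical
  obtain ⟨t, ht⟩ : ∃ t, Nat.find hex = t + 1 := by
    refine ⟨Nat.find hex - 1, ?_⟩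
    have : Nat.find hex ≠ 0 := fun h => by
      have := Nat.find_spec hex
      rw [h] at this
      exact absurd this (not_le.2 hxb)
    omega
  have ht1 : b ≤ H^[t + 1] x := ht ▸ Nat.find_spec hex
  have hlt : ∀ i < t + 1, H^[i] x < b := fun i hi => not_le.1 (Nat.find_min hex (ht ▸ hi))
  have ht2 : H^[t + 1] x ≤ H b := by
    rw [Function.iterate_succ_apply']
    exact R.strictMono.monotone (hlt t (Nat.lt_succ_self t)).le
  refine ⟨t + 1, ?_, fun i hi => ⟨?_, (hlt i hi).trans_le hbδ⟩⟩
  · have hsum : ∑ j ∈ Finset.range (t + 1), (P (H^[j] (H x)) - P (H^[j] x)) ≤ K := by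
      simp only [← Function.iterate_succ_apply]
      rw [Finset.sum_range_sub fun j => P (H^[j] x)]
      have h1 := R.monotone ht2
      have h2 := R.monotone hx.1.le
      simp only [Function.iterate_zero, id]
      linarith
    refine R.le_expo hxH (left_mem_Icc.2 hxH.le) hsum ?_
    have h1 := hδ₁' (y := x) (by
      rw [Real.dist_eq, sub_zero, abs_of_pos hx.1]
      exact hx.2.trans_le (min_le_left _ _))
    rw [Real.dist_eq, sub_zero] at h1
    have h2 := (le_abs_self _).trans h1.le
    have h3 : H m - m ≤ H (H^[t + 1] x) - H^[t + 1] x := hmin ⟨ht1, ht2⟩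
    rw [← Function.iterate_succ_apply (f := H), Function.iterate_succ_apply' (f := H)]
    calc Real.exp (K + L) * (H x - x)
        ≤ Real.exp (K + L) * (Real.exp (-(K + L)) * (H m - m)) :=
          mul_le_mul_of_nonneg_left h2 (Real.exp_pos _).le
      _ = H m - m := by rw [← mul_assoc, ← Real.exp_add, add_neg_cancel, Real.exp_zero, one_mul]
      _ ≤ _ := h3
  · have := R.strictMono_iterate i hx.1
    rwa [Function.iterate_fixed h0] at this

theorem eventually_exit_right (R : WeaklyExpandingLift d H P V) {p : ℝ} {k : ℤ} (hp : H p = p + k)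
    {δ : ℝ} (hδ : 0 < δ) (L : ℝ) : ∃ δ' > 0, ∀ x ∈ Ioo p (p + δ'), ∃ t, L ≤ expo H t x ∧
      ∀ i < t, ∃ l : ℤ, |H^[i] x - p - l| < δ := by
  obtain ⟨δ', hδ', h⟩ := (R.shift_lift p k).exists_exit_right_zero (by simp [shift, hp]) hδ L
  refine ⟨δ', hδ', fun x hx => ?_⟩
  obtain ⟨t, ht, hi⟩ := h (x - p) ⟨by linarith [hx.1], by linarith [hx.2]⟩
  rw [R.expo_shift, sub_add_cancel] at ht
  refine ⟨t, ht, fun i hit => ?_⟩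
  obtain ⟨l, hl⟩ := R.shift_iterate p k i
  have h1 := hi i hit
  rw [hl, sub_add_cancel] at h1
  exact ⟨l, by rw [abs_of_pos h1.1]; exact h1.2⟩

/-- Orbits that start close to a fixed point (modulo `1`) pick up much expansion before they leave
a given neighbourhood of it. -/
theorem eventually_exit (R : WeaklyExpandingLift d H P V) {p : ℝ} {k : ℤ} (hp : H p = p + k)
    {δ : ℝ} (hδ : 0 < δ) (L : ℝ) : ∀ᶠ x in 𝓝[≠] p, ∃ t, L ≤ expo H t x ∧
      ∀ i < t, ∃ l : ℤ, |H^[i] x - p - l| < δ := by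
  obtain ⟨δ₁, hδ₁, h₁⟩ := R.eventually_exit_right hp hδ L
  obtain ⟨δ₂, hδ₂, h₂⟩ := R.reflect_lift.eventually_exit_right (p := -p) (k := -k)
    (by rw [reflect, neg_neg, hp]; push_cast; ring) hδ L
  rw [eventually_nhdsWithin_iff, Metric.eventually_nhds_iff]
  refine ⟨min δ₁ δ₂, lt_min hδ₁ hδ₂, fun x hx hxp => ?_⟩
  rw [Real.dist_eq, lt_min_iff, abs_lt, abs_lt] at hx
  rcases lt_or_gt_of_ne hxp with h | h
  · obtain ⟨t, ht, hi⟩ := h₂ (-x) ⟨neg_lt_neg h, by linarith [hx.2.1]⟩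
    rw [expo_reflect, neg_neg] at ht
    refine ⟨t, ht, fun i hit => ?_⟩
    obtain ⟨l, hl⟩ := hi i hit
    refine ⟨-l, ?_⟩
    rw [reflect_iterate, neg_neg] at hl
    rw [← abs_neg]
    push_cast
    convert hl using 2
    ring
  · exact h₁ x ⟨h, by linarith [hx.1.2]⟩

/-! ### Finiteness of the parabolic points -/

theorem parabolic_add_int (R : WeaklyExpandingLift d H P V) {p : ℝ} (hp : p ∈ parabolic H)
    (l : ℤ) : p + l ∈ parabolic H := by
  obtain ⟨r, hr, k, hk, he⟩ := hp
  obtain ⟨m, hm⟩ := R.exists_iterate_add_int r l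
  refine ⟨r, hr, k + m - l, ?_, by rw [R.expo_add_int, he]⟩
  rw [hm, hk]
  push_cast
  ring

theorem parabolic_add_int_iff (R : WeaklyExpandingLift d H P V) {p : ℝ} (l : ℤ) :
    p + l ∈ parabolic H ↔ p ∈ parabolic H := by
  refine ⟨fun h => ?_, fun h => R.parabolic_add_int h l⟩
  have := R.parabolic_add_int h (-l)
  push_cast at this
  simpa using this

/-- Along a parabolic orbit the derivatives of the iterates are periodic in time. -/
theorem expo_mod_of_parabolic (R : WeaklyExpandingLift d H P V) {p : ℝ} {r : ℕ} {k : ℤ}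
    (hk : H^[r] p = p + k) (he : expo H r p = 0) (n : ℕ) :
    expo H n p = expo H (n % r) p ∧ ∃ l : ℤ, H^[n] p = H^[n % r] p + l := by
  obtain ⟨⟨l, hl⟩, h2⟩ := R.periodic_mul hk (n / r)
  rw [he, mul_zero] at h2
  constructor
  · conv_lhs => rw [← Nat.div_add_mod n r]
    rw [expo_add, h2, hl, R.expo_add_int, zero_add]
  · obtain ⟨l', hl'⟩ := R.exists_iterate_add_int (n % r) l
    refine ⟨l', ?_⟩
    conv_lhs => rw [← Nat.div_add_mod n r]
    rw [add_comm, Function.iterate_add_apply, hl, hl']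

/-- The parabolic points along whose orbit the derivative of the iterates never exceeds `1`. They
do not accumulate: at a limit point `x` the derivatives would not exceed `1` either, so the
orbit of `x` would end in a parabolic orbit, and points close to `x` pick up expansion when they
leave the neighbourhood of that orbit. -/
theorem finite_parabolic_nonpos (R : WeaklyExpandingLift d H P V) :
    {p | p ∈ Ico (0 : ℝ) 1 ∧ p ∈ parabolic H ∧ ∀ n, expo H n p ≤ 0}.Finite := by
  by_contra hinf
  obtain ⟨x, -, hx⟩ := Set.Infinite.exists_accPt_of_subset_isCompact hinf
    (isCompact_Icc (a := (0 : ℝ)) (b := 1)) fun p hp => ⟨hp.1.1, hp.1.2.le⟩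
  rw [accPt_iff_frequently_nhdsNE] at hx
  have hx0 : ∀ n, expo H n x ≤ 0 := by
    intro n
    by_contra! hpos
    have h1 : ∀ᶠ y in 𝓝[≠] x, 0 < expo H n y :=
      (((R.continuous_expo n).tendsto x).mono_left nhdsWithin_le_nhds).eventually (lt_mem_nhds hpos)
    obtain ⟨y, hy, hy'⟩ := (hx.and_eventually h1).exists
    linarith [hy.2.2 n]
  obtain ⟨i, r, hr, k, hk, -⟩ := R.exists_parabolic_of_bounded hx0
  have h2 := (R.iterate hr).eventually_exit hk one_pos (2 - expo H i x)
  have h3 : Tendsto H^[i] (𝓝[≠] x) (𝓝[≠] (H^[i] x)) :=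
    tendsto_nhdsWithin_iff.2 ⟨((R.continuous_iterate i).tendsto x).mono_left nhdsWithin_le_nhds, by
      filter_upwards [self_mem_nhdsWithin] with y hy
      exact fun h => hy ((R.strictMono_iterate i).injective h)⟩
  have h4 : ∀ᶠ y in 𝓝[≠] x, expo H i x - 1 < expo H i y :=
    (((R.continuous_expo i).tendsto x).mono_left nhdsWithin_le_nhds).eventually
      (lt_mem_nhds (by linarith))
  obtain ⟨y, hy, ⟨t, ht, -⟩, hy'⟩ := (hx.and_eventually ((h3.eventually h2).and h4)).exists
  rw [R.expo_iterate] at ht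
  have h5 := hy.2.2 (i + r * t)
  rw [expo_add] at h5
  linarith

/-- On each parabolic orbit there is a point at which no iterate has derivative greater than `1`,
namely the one reached at the time when the derivative of the iterate is maximal. -/
theorem finite_parabolic (R : WeaklyExpandingLift d H P V) :
    (parabolic H ∩ Ico 0 1).Finite := by
  refine Set.Finite.subset (R.finite_parabolic_nonpos.biUnion
    (t := fun a => range fun j => Int.fract (H^[j] a)) ?_) ?_
  · rintro a ⟨-, ⟨r, hr, k, hk, he⟩, -⟩
    refine ((Set.finite_Iio r).image fun j => Int.fract (H^[j] a)).subset ?_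
    rintro _ ⟨j, rfl⟩
    obtain ⟨-, l, hl⟩ := R.expo_mod_of_parabolic hk he j
    exact ⟨j % r, Nat.mod_lt _ (by omega), by simp only [hl, Int.fract_add_intCast]⟩
  · rintro p ⟨⟨r, hr, k, hk, he⟩, hp⟩
    obtain ⟨i, hi, hmax⟩ := Finset.exists_max_image (Finset.range r) (fun i => expo H i p)
      ⟨0, Finset.mem_range.2 (by omega)⟩
    have hi' := Finset.mem_range.1 hi
    set a := Int.fract (H^[i] p) with ha
    have haw : H^[i] p = a + ⌊H^[i] p⌋ := (Int.fract_add_floor _).symm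
    have hexp : ∀ n, expo H n a = expo H n (H^[i] p) := fun n => by
      rw [haw, R.expo_add_int]
    have hap : a ∈ parabolic H := by
      rw [← R.parabolic_add_int_iff ⌊H^[i] p⌋, ← haw]
      obtain ⟨l, hl⟩ := R.exists_iterate_add_int i k
      refine ⟨r, hr, l, ?_, ?_⟩
      · rw [← Function.iterate_add_apply, add_comm, Function.iterate_add_apply, hk, hl]
      · have h1 := expo_add H i r p
        have h2 := expo_add H r i p
        rw [hk, R.expo_add_int, he] at h2
        rw [add_comm] at h2
        linarith
    refine mem_biUnion (x := a) ⟨⟨Int.fract_nonneg _, Int.fract_lt_one _⟩, hap, fun n => ?_⟩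
      ⟨r - i, ?_⟩
    · rw [hexp]
      have h1 := expo_add H i n p
      have h2 := (R.expo_mod_of_parabolic hk he (i + n)).1
      have h3 := hmax ((i + n) % r) (Finset.mem_range.2 (Nat.mod_lt _ (by omega)))
      linarith
    · obtain ⟨l, hl⟩ := R.exists_iterate_add_int (r - i) (-⌊H^[i] p⌋)
      have h1 : a = H^[i] p + ((-⌊H^[i] p⌋ : ℤ) : ℝ) := by
        simp only [ha, Int.fract]
        push_cast
        ring
      simp only
      rw [h1, hl, ← Function.iterate_add_apply, Nat.sub_add_cancel hi'.le, hk,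
        Int.fract_add_intCast, Int.fract_add_intCast, Int.fract_eq_self.2 ⟨hp.1, hp.2⟩]

variable {Q : ℝ → ℝ}

/-! ### Lower bounds for the derivatives of the iterates -/

/-- A continuous `1`-periodic function `Q ≥ 0` whose zeros are the parabolic points, for a lift `H`
that fixes all of them modulo `1`. The sets `{Q < δ}` serve as neighbourhoods of the set of
parabolic points. -/
structure ParabolicGauge (H Q : ℝ → ℝ) : Prop where
  continuous : Continuous Q
  add_int : ∀ (x : ℝ) (k : ℤ), Q (x + k) = Q x
  nonneg : ∀ x, 0 ≤ Q x
  eq_zero_iff : ∀ x, Q x = 0 ↔ x ∈ parabolic H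
  fixed : ∀ p ∈ parabolic H, ∃ k : ℤ, H p = p + k

theorem _root_.exists_abs_le_of_periodic {f : ℝ → ℝ} (hc : Continuous f)
    (hp : ∀ (x : ℝ) (k : ℤ), f (x + k) = f x) : ∃ M, ∀ x, |f x| ≤ M := by
  obtain ⟨M, hM⟩ := (isCompact_Icc (a := (0 : ℝ)) (b := 1)).exists_bound_of_continuousOn
    hc.continuousOn
  refine ⟨M, fun x => ?_⟩
  have h1 := hp (Int.fract x) ⌊x⌋
  rw [Int.fract_add_floor] at h1
  rw [h1]
  exact hM _ ⟨Int.fract_nonneg _, (Int.fract_lt_one _).le⟩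

/-- A periodic set that is a neighbourhood of all zeros of `Q` contains a sublevel set of `Q`. -/
theorem ParabolicGauge.exists_lt_subset (G : ParabolicGauge H Q) {U : Set ℝ}
    (hU : ∀ p ∈ parabolic H, U ∈ 𝓝 p) (hper : ∀ (x : ℝ) (k : ℤ), x ∈ U → x + k ∈ U) :
    ∃ δ > 0, ∀ x, Q x < δ → x ∈ U := by
  have hK : IsCompact (Icc (0 : ℝ) 1 \ interior U) := isCompact_Icc.diff isOpen_interior
  have hred : ∀ x, Int.fract x ∈ U → x ∈ U := fun x hx => by
    have := hper _ ⌊x⌋ hx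
    rwa [Int.fract_add_floor] at this
  have hfr : ∀ x, Q (Int.fract x) = Q x := fun x => by
    have := G.add_int (Int.fract x) ⌊x⌋
    rw [Int.fract_add_floor] at this
    exact this.symm
  have hmem : ∀ x : ℝ, Int.fract x ∈ Icc (0 : ℝ) 1 := fun x =>
    ⟨Int.fract_nonneg _, (Int.fract_lt_one _).le⟩
  rcases (Icc (0 : ℝ) 1 \ interior U).eq_empty_or_nonempty with he | hne
  · refine ⟨1, one_pos, fun x _ => hred x ?_⟩
    by_contra hx
    have : Int.fract x ∈ Icc (0 : ℝ) 1 \ interior U :=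
      ⟨hmem x, fun h => hx (interior_subset h)⟩
    rw [he] at this
    exact this
  · obtain ⟨m, hm, hmin⟩ := hK.exists_isMinOn hne G.continuous.continuousOn
    have hpos : 0 < Q m := by
      refine lt_of_le_of_ne (G.nonneg m) fun h => hm.2 ?_
      exact mem_interior_iff_mem_nhds.2 (hU m ((G.eq_zero_iff m).1 h.symm))
    refine ⟨Q m, hpos, fun x hx => hred x ?_⟩
    by_contra hxU
    have : Q m ≤ Q (Int.fract x) := hmin ⟨hmem x, fun h => hxU (interior_subset h)⟩
    rw [hfr] at this
    linarith

theorem ParabolicGauge.logSlope_eq_zero (G : ParabolicGauge H Q)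
    (R : WeaklyExpandingLift d H P V) {p : ℝ} (hp : p ∈ parabolic H) : logSlope H p = 0 := by
  obtain ⟨k, hk⟩ := G.fixed p hp
  obtain ⟨r, hr, -, -, he⟩ := hp
  have := (R.periodic_mul (r := 1) (p := p) (k := k) (by simpa using hk) r).2
  rw [one_mul, he, expo_one] at this
  have hr' : (r : ℝ) ≠ 0 := by
    have : r ≠ 0 := by omega
    exact_mod_cast this
  rcases mul_eq_zero.1 this.symm with h | h
  · exact absurd h hr'
  · exact h

theorem ParabolicGauge.map_mem (G : ParabolicGauge H Q)
    (R : WeaklyExpandingLift d H P V) {p : ℝ} (hp : p ∈ parabolic H) : H p ∈ parabolic H := by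
  obtain ⟨k, hk⟩ := G.fixed p hp
  rw [hk]
  exact R.parabolic_add_int hp k

/-- Close to the parabolic points the derivative is greater than `1`. -/
theorem ParabolicGauge.exists_pos (G : ParabolicGauge H Q) (R : WeaklyExpandingLift d H P V) :
    ∃ δ > 0, ∀ x, Q x < δ → x ∈ parabolic H ∨ 0 < logSlope H x := by
  refine G.exists_lt_subset (U := {x | x ∈ parabolic H ∨ 0 < logSlope H x}) (fun p hp => ?_)
    fun x k hx => ?_
  · obtain ⟨k, hk⟩ := G.fixed p hp
    have h := R.eventually_pos 1 le_rfl k p (by simpa using hk)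
    rw [eventually_nhdsWithin_iff] at h
    filter_upwards [h] with x hx
    by_cases hxp : x = p
    · exact Or.inl (hxp ▸ hp)
    · exact Or.inr (by simpa [expo_one] using hx hxp)
  · exact hx.imp (fun h => R.parabolic_add_int h k) fun h => by rwa [R.logSlope_add_int]

theorem ParabolicGauge.exists_exit (G : ParabolicGauge H Q) (R : WeaklyExpandingLift d H P V)
    {δ : ℝ} (hδ : 0 < δ) (L : ℝ) : ∃ δ' > 0, ∀ x, Q x < δ' → x ∈ parabolic H ∨
      ∃ t, L ≤ expo H t x ∧ ∀ i < t, Q (H^[i] x) < δ := by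
  refine G.exists_lt_subset (U := {x | x ∈ parabolic H ∨
      ∃ t, L ≤ expo H t x ∧ ∀ i < t, Q (H^[i] x) < δ}) (fun p hp => ?_) fun x k hx => ?_
  · obtain ⟨k, hk⟩ := G.fixed p hp
    have hQp : Q p < δ := by rwa [(G.eq_zero_iff p).2 hp]
    obtain ⟨δ₁, hδ₁, h₁⟩ := Metric.eventually_nhds_iff.1
      ((G.continuous.tendsto p).eventually (gt_mem_nhds hQp))
    have h := R.eventually_exit hk hδ₁ L
    rw [eventually_nhdsWithin_iff] at h
    filter_upwards [h] with x hx
    by_cases hxp : x = p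
    · exact Or.inl (hxp ▸ hp)
    · obtain ⟨t, ht, hi⟩ := hx hxp
      refine Or.inr ⟨t, ht, fun i hit => ?_⟩
      obtain ⟨l, hl⟩ := hi i hit
      have h2 := h₁ (y := H^[i] x - l) (by rw [Real.dist_eq, sub_right_comm]; exact hl)
      have h3 := G.add_int (H^[i] x - l) l
      rw [sub_add_cancel] at h3
      rwa [h3]
  · rcases hx with h | ⟨t, ht, hi⟩
    · exact Or.inl (R.parabolic_add_int h k)
    · refine Or.inr ⟨t, by rwa [R.expo_add_int], fun i hit => ?_⟩
      obtain ⟨l, hl⟩ := R.exists_iterate_add_int i k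
      rw [hl, G.add_int]
      exact hi i hit

theorem expo_nonneg_of_forall {x : ℝ} {n : ℕ} (h : ∀ i < n, 0 ≤ logSlope H (H^[i] x)) :
    0 ≤ expo H n x :=
  Finset.sum_nonneg fun i hi => h i (Finset.mem_range.1 hi)

theorem ParabolicGauge.iterate_mem (G : ParabolicGauge H Q) (R : WeaklyExpandingLift d H P V)
    {p : ℝ} (hp : p ∈ parabolic H) (n : ℕ) : H^[n] p ∈ parabolic H := by
  induction n with
  | zero => exact hp
  | succ n ih =>
    rw [Function.iterate_succ_apply']
    exact G.map_mem R ih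

theorem ParabolicGauge.expo_eq_zero (G : ParabolicGauge H Q) (R : WeaklyExpandingLift d H P V)
    {p : ℝ} (hp : p ∈ parabolic H) (n : ℕ) : expo H n p = 0 := by
  rw [expo_def]
  exact Finset.sum_eq_zero fun i _ => G.logSlope_eq_zero R (G.iterate_mem R hp i)

/-- The derivatives of all iterates have a common positive lower bound. Locally, either the
derivative of some iterate exceeds `1`, or the orbit enters a small neighbourhood of the parabolic
points, where it gains more than it may have lost before. -/
theorem ParabolicGauge.exists_le_expo (G : ParabolicGauge H Q)
    (R : WeaklyExpandingLift d H P V) : ∃ C, 0 ≤ C ∧ ∀ n x, -C ≤ expo H n x := by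
  obtain ⟨M, hM⟩ := exists_abs_le_of_periodic R.continuous_logSlope R.logSlope_add_int
  have hM0 : 0 ≤ M := (abs_nonneg _).trans (hM 0)
  have hlow : ∀ n x, -(n * M) ≤ expo H n x := fun n x => by
    have h1 : |expo H n x| ≤ n * M := by
      rw [expo_def]
      refine (Finset.abs_sum_le_sum_abs _ _).trans ((Finset.sum_le_sum fun i _ => hM _).trans ?_)
      simp
    exact (abs_le.1 h1).1
  have hlow' : ∀ {n m : ℕ} x, n ≤ m → -(m * M) ≤ expo H n x := fun {n m} x hnm => by
    have h1 : (n : ℝ) * M ≤ m * M := mul_le_mul_of_nonneg_right (by exact_mod_cast hnm) hM0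
    linarith [hlow n x]
  obtain ⟨δ, hδ, hpos⟩ := G.exists_pos R
  have hnn : ∀ x, Q x < δ → 0 ≤ logSlope H x := fun x hx => by
    rcases hpos x hx with h | h
    · exact (G.logSlope_eq_zero R h).ge
    · exact h.le
  -- By compactness, a bound that fails at time `n` only if the derivative exceeded `1` before.
  have key : ∃ c, ∀ y ∈ Icc (0 : ℝ) 1, ∀ n, -c ≤ expo H n y ∨
      ∃ t, 1 ≤ t ∧ t ≤ n ∧ 0 < expo H t y := by
    refine isCompact_Icc.induction_on (p := fun s => ∃ c, ∀ y ∈ s, ∀ n, -c ≤ expo H n y ∨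
      ∃ t, 1 ≤ t ∧ t ≤ n ∧ 0 < expo H t y) ⟨0, by simp⟩ ?_ ?_ ?_
    · rintro s t hst ⟨c, hc⟩
      exact ⟨c, fun y hy => hc y (hst hy)⟩
    · rintro s t ⟨c, hc⟩ ⟨c', hc'⟩
      refine ⟨max c c', fun y hy n => ?_⟩
      rcases hy with hy | hy
      · exact (hc y hy n).imp_left fun h => (neg_le_neg (le_max_left _ _)).trans h
      · exact (hc' y hy n).imp_left fun h => (neg_le_neg (le_max_right _ _)).trans h
    · intro x _
      by_cases hx : ∃ t, 0 < expo H t x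
      · obtain ⟨t, ht⟩ := hx
        refine ⟨{y | 0 < expo H t y}, mem_nhdsWithin_of_mem_nhds
          (((R.continuous_expo t).tendsto x).eventually (lt_mem_nhds ht)), t * M,
          fun y hy n => ?_⟩
        rcases le_or_gt t n with h | h
        · refine Or.inr ⟨t, ?_, h, hy⟩
          by_contra! h0
          obtain rfl : t = 0 := by omega
          simp [expo_zero] at ht
        · exact Or.inl (hlow' y h.le)
      · push Not at hx
        obtain ⟨i, hi⟩ := R.exists_parabolic_of_bounded hx
        obtain ⟨δ', hδ', hexit⟩ := G.exists_exit R hδ (i * M + 1)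
        refine ⟨{y | Q (H^[i] y) < δ'}, mem_nhdsWithin_of_mem_nhds
          (((G.continuous.comp (R.continuous_iterate i)).tendsto x).eventually
            (gt_mem_nhds ?_)), i * M, fun y hy n => ?_⟩
        · rwa [Function.comp, (G.eq_zero_iff _).2 hi]
        rcases le_or_gt n i with h | h
        · exact Or.inl (hlow' y h)
        · obtain ⟨m, rfl⟩ := Nat.exists_eq_add_of_le h.le
          rcases hexit _ hy with hp | ⟨t, ht, ht'⟩
          · left
            rw [expo_add, G.expo_eq_zero R hp, add_zero]
            exact hlow i y
          · rcases le_or_gt t m with htm | htm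
            · refine Or.inr ⟨i + t, ?_, by omega, ?_⟩
              · by_contra! h0
                obtain rfl : t = 0 := by omega
                rw [expo_zero] at ht
                have : 0 ≤ (i : ℝ) * M := by positivity
                linarith
              · rw [expo_add]
                linarith [hlow i y]
            · left
              rw [expo_add]
              have := expo_nonneg_of_forall (H := H) (n := m)
                fun j hj => hnn _ (ht' j (hj.trans htm))
              linarith [hlow i y]
  -- Discard the initial piece of orbit with derivative greater than `1`, and argue by induction.
  obtain ⟨c, hc⟩ := key
  refine ⟨max c 0, le_max_right _ _, fun n => ?_⟩
  induction n using Nat.strong_induction_on with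
  | _ n ih =>
    intro x
    have hfr : ∀ n, expo H n x = expo H n (Int.fract x) := fun n => by
      have := R.expo_add_int n (Int.fract x) ⌊x⌋
      rwa [Int.fract_add_floor] at this
    rcases hc (Int.fract x) ⟨Int.fract_nonneg _, (Int.fract_lt_one _).le⟩ n with h | ⟨t, h1, h2, h3⟩
    · rw [hfr]
      exact (neg_le_neg (le_max_left _ _)).trans h
    · obtain ⟨m, rfl⟩ := Nat.exists_eq_add_of_le h2
      rw [expo_add]
      rw [← hfr] at h3
      linarith [ih m (by omega) (H^[t] x)]

/-- In a bounded number of steps every orbit gains a given amount of expansion or comes close to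
the parabolic points. -/
theorem ParabolicGauge.exists_time (G : ParabolicGauge H Q) (R : WeaklyExpandingLift d H P V)
    (L : ℝ) {δ : ℝ} (hδ : 0 < δ) :
    ∃ N : ℕ, ∀ x, ∃ t ≤ N, L ≤ expo H t x ∨ Q (H^[t] x) < δ := by
  have key : ∃ N : ℕ, ∀ x ∈ Icc (0 : ℝ) 1, ∃ t ≤ N, L ≤ expo H t x ∨ Q (H^[t] x) < δ := by
    refine isCompact_Icc.induction_on
      (p := fun s => ∃ N : ℕ, ∀ x ∈ s, ∃ t ≤ N, L ≤ expo H t x ∨ Q (H^[t] x) < δ)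
      ⟨0, by simp⟩ ?_ ?_ ?_
    · rintro s t hst ⟨N, hN⟩
      exact ⟨N, fun y hy => hN y (hst hy)⟩
    · rintro s t ⟨N, hN⟩ ⟨N', hN'⟩
      refine ⟨max N N', fun y hy => ?_⟩
      rcases hy with hy | hy
      · obtain ⟨t, ht, h⟩ := hN y hy
        exact ⟨t, ht.trans (le_max_left _ _), h⟩
      · obtain ⟨t, ht, h⟩ := hN' y hy
        exact ⟨t, ht.trans (le_max_right _ _), h⟩
    · intro x _
      by_cases hx : ∃ t, L < expo H t x
      · obtain ⟨t, ht⟩ := hx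
        exact ⟨{y | L < expo H t y}, mem_nhdsWithin_of_mem_nhds
          (((R.continuous_expo t).tendsto x).eventually (lt_mem_nhds ht)), t,
          fun y hy => ⟨t, le_rfl, Or.inl (le_of_lt hy)⟩⟩
      · push Not at hx
        obtain ⟨i, hi⟩ := R.exists_parabolic_of_bounded hx
        refine ⟨{y | Q (H^[i] y) < δ}, mem_nhdsWithin_of_mem_nhds
          (((G.continuous.comp (R.continuous_iterate i)).tendsto x).eventually
            (gt_mem_nhds ?_)), i, fun y hy => ⟨i, le_rfl, Or.inr hy⟩⟩
        rwa [Function.comp, (G.eq_zero_iff _).2 hi]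
  obtain ⟨N, hN⟩ := key
  refine ⟨N, fun x => ?_⟩
  obtain ⟨t, ht, h⟩ := hN (Int.fract x) ⟨Int.fract_nonneg _, (Int.fract_lt_one _).le⟩
  have h1 := R.expo_add_int t (Int.fract x) ⌊x⌋
  obtain ⟨l, hl⟩ := R.exists_iterate_add_int t ⌊x⌋
  have h2 := hl (Int.fract x)
  rw [Int.fract_add_floor] at h1 h2
  rw [← h1] at h
  refine ⟨t, ht, h.imp_right fun h => ?_⟩
  rwa [h2, G.add_int]

/-! ### A continuous solution of the cohomological inequality -/

/-- A continuous function `v` with `ψ + v ≤ log H' + v ∘ H`, where `ψ ≥ 0` vanishes only at the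
parabolic points. Here `v` is the infimum over `n` of the Birkhoff sums of `log H' - ψ` up to time
`n`; for small `ψ` it is attained within a bounded time, and vanishes near the parabolic points,
where `log H' - ψ` is nonnegative. -/
theorem ParabolicGauge.exists_coboundary (G : ParabolicGauge H Q)
    (R : WeaklyExpandingLift d H P V) :
    ∃ ψ v : ℝ → ℝ, Continuous ψ ∧ Continuous v ∧ (∀ (x : ℝ) (k : ℤ), ψ (x + k) = ψ x) ∧
      (∀ (x : ℝ) (k : ℤ), v (x + k) = v x) ∧ (∀ x, x ∉ parabolic H → 0 < ψ x) ∧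
      (∀ x, ψ x + v x ≤ logSlope H x + v (H x)) ∧ ∃ δ > 0, ∀ x, Q x < δ → v x = 0 := by
  obtain ⟨δ₁, hδ₁, hpos⟩ := G.exists_pos R
  obtain ⟨C, hC, hlow⟩ := G.exists_le_expo R
  obtain ⟨δ, hδ, hexit⟩ := G.exists_exit R (half_pos hδ₁) (4 * (C + 1))
  obtain ⟨N, hN⟩ := G.exists_time R (C + 2) hδ
  have hnn : ∀ x, Q x < δ₁ → 0 ≤ logSlope H x := fun x hx => by
    rcases hpos x hx with h | h
    · exact (G.logSlope_eq_zero R h).ge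
    · exact h.le
  have hN1 : (0 : ℝ) < 1 / (N + 1) := by positivity
  -- Near the parabolic points `ψ` is at most half of `log H'`, so that `log H' - ψ ≥ 0` there;
  -- everywhere it is so small that it costs at most `1` in the time `N`.
  set ψ : ℝ → ℝ := fun x => min (1 / (N + 1)) (max (logSlope H x / 2) (Q x - δ₁ / 2)) with hψ
  have hψc : Continuous ψ :=
    continuous_const.min ((R.continuous_logSlope.div_const 2).max
      (G.continuous.sub continuous_const))
  have hψp : ∀ (x : ℝ) (k : ℤ), ψ (x + k) = ψ x := fun x k => by
    simp only [hψ, R.logSlope_add_int, G.add_int]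
  have hψle : ∀ x, ψ x ≤ 1 / (N + 1) := fun x => min_le_left _ _
  have hψhalf : ∀ x, Q x < δ₁ / 2 → ψ x ≤ logSlope H x / 2 := fun x hx =>
    (min_le_right _ _).trans (max_le le_rfl (by linarith [hnn x (by linarith)]))
  have hψ0 : ∀ x, 0 ≤ ψ x := fun x => by
    refine le_min hN1.le ?_
    rcases lt_or_ge (Q x) δ₁ with h | h
    · exact le_max_of_le_left (by linarith [hnn x h])
    · exact le_max_of_le_right (by linarith)
  have hψpos : ∀ x, x ∉ parabolic H → 0 < ψ x := fun x hx => by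
    refine lt_min hN1 ?_
    rcases lt_or_ge (Q x) δ₁ with h | h
    · exact lt_max_of_lt_left (by linarith [(hpos x h).resolve_left hx])
    · exact lt_max_of_lt_right (by linarith)
  set Φ : ℝ → ℝ := fun x => logSlope H x - ψ x with hΦ
  set S : ℕ → ℝ → ℝ := fun n x => birkhoffSum H Φ n x with hS
  have hSadd : ∀ m n x, S (m + n) x = S m x + S n (H^[m] x) := fun m n x =>
    birkhoffSum_add _ _ _ _ _
  have hS0 : ∀ x, S 0 x = 0 := fun x => birkhoffSum_zero _ _ _
  have hSψ : ∀ n x, S n x = expo H n x - birkhoffSum H ψ n x := fun n x =>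
    Finset.sum_sub_distrib _ _
  have hSN : ∀ n ≤ N, ∀ x, expo H n x - 1 ≤ S n x := fun n hn x => by
    have h1 : birkhoffSum H ψ n x ≤ ∑ _j ∈ Finset.range n, (1 / (N + 1) : ℝ) :=
      Finset.sum_le_sum fun j _ => hψle _
    have h2 : (n : ℝ) * (1 / (N + 1)) ≤ 1 := by
      rw [mul_one_div, div_le_one (by positivity)]
      have : (n : ℝ) ≤ N := by exact_mod_cast hn
      linarith
    rw [Finset.sum_const, Finset.card_range, nsmul_eq_mul] at h1
    rw [hSψ]
    linarith
  have hSN' : ∀ n ≤ N, ∀ x, -(C + 1) ≤ S n x := fun n hn x => by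
    linarith [hSN n hn x, hlow n x]
  have hnear : ∀ n x, (∀ i < n, Q (H^[i] x) < δ₁ / 2) → expo H n x / 2 ≤ S n x ∧ 0 ≤ S n x := by
    intro n x h
    have h1 : expo H n x / 2 ≤ S n x := by
      rw [expo_def, Finset.sum_div]
      refine Finset.sum_le_sum fun j hj => ?_
      have := hψhalf _ (h j (Finset.mem_range.1 hj))
      simp only [hΦ]
      linarith
    have h2 := expo_nonneg_of_forall (H := H) (x := x) (n := n)
      fun i hi => hnn _ (by linarith [h i hi])
    exact ⟨h1, by linarith⟩
  have hpar : ∀ p ∈ parabolic H, ∀ n, S n p = 0 := fun p hp n =>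
    Finset.sum_eq_zero fun i _ => by
      have h1 := G.iterate_mem R hp i
      have h2 := G.logSlope_eq_zero R h1
      have h3 := hψhalf (H^[i] p) (by rw [(G.eq_zero_iff _).2 h1]; linarith)
      have h4 := hψ0 (H^[i] p)
      simp only [hΦ]
      linarith
  -- A Birkhoff sum `S n x` is at least one of those up to time `N`, unless the orbit has gained
  -- `C + 1` at some time `t ≤ n`.
  have hdich : ∀ n x, (∃ j ≤ N, S j x ≤ S n x) ∨ ∃ t, 1 ≤ t ∧ t ≤ n ∧ C + 1 ≤ S t x := by
    intro n x
    rcases le_or_gt n N with h | h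
    · exact Or.inl ⟨n, h, le_rfl⟩
    obtain ⟨t, ht, hgain | hclose⟩ := hN x
    · refine Or.inr ⟨t, ?_, by omega, by linarith [hSN t ht x]⟩
      by_contra! h0
      obtain rfl : t = 0 := by omega
      rw [expo_zero] at hgain
      linarith
    · obtain ⟨m, rfl⟩ := Nat.exists_eq_add_of_le (ht.trans h.le)
      rcases hexit _ hclose with hp | ⟨s, hs, hs'⟩
      · exact Or.inl ⟨t, ht, by rw [hSadd, hpar _ hp, add_zero]⟩
      · rcases le_or_gt s m with hsm | hsm
        · have h1 := (hnear s _ hs').1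
          refine Or.inr ⟨t + s, ?_, by omega, ?_⟩
          · by_contra! h0
            obtain rfl : s = 0 := by omega
            rw [expo_zero] at hs
            linarith
          · rw [hSadd]
            linarith [hSN' t ht x]
        · refine Or.inl ⟨t, ht, ?_⟩
          rw [hSadd]
          linarith [(hnear m _ fun i hi => hs' i (hi.trans hsm)).2]
  have hSlow : ∀ n x, -(C + 1) ≤ S n x := by
    intro n
    induction n using Nat.strong_induction_on with
    | _ n ih =>
      intro x
      rcases hdich n x with ⟨j, hj, hle⟩ | ⟨t, h1, h2, h3⟩
      · exact (hSN' j hj x).trans hle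
      · obtain ⟨m, rfl⟩ := Nat.exists_eq_add_of_le h2
        rw [hSadd]
        linarith [ih m (by omega) (H^[t] x)]
  have hSmin : ∀ n x, ∃ j ≤ N, S j x ≤ S n x := by
    intro n x
    rcases hdich n x with h | ⟨t, h1, h2, h3⟩
    · exact h
    · obtain ⟨m, rfl⟩ := Nat.exists_eq_add_of_le h2
      refine ⟨0, Nat.zero_le _, ?_⟩
      rw [hSadd, hS0]
      linarith [hSlow m (H^[t] x)]
  have hne : (Finset.range (N + 1)).Nonempty := ⟨0, by simp⟩
  have hΦc : Continuous Φ := R.continuous_logSlope.sub hψc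
  have hSc : ∀ n, Continuous (S n) := fun n =>
    continuous_finsetSum _ fun j _ => hΦc.comp (R.continuous_iterate j)
  have hSp : ∀ n (x : ℝ) (k : ℤ), S n (x + k) = S n x := fun n x k =>
    Finset.sum_congr rfl fun j _ => by
      obtain ⟨l, hl⟩ := R.exists_iterate_add_int j k
      simp only [hΦ, hl, R.logSlope_add_int, hψp]
  refine ⟨ψ, fun x => (Finset.range (N + 1)).inf' hne fun n => S n x, hψc,
    Continuous.finset_inf'_apply hne fun n _ => hSc n, hψp, fun x k => by simp only [hSp],
    hψpos, fun x => ?_, δ, hδ, fun x hx => ?_⟩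
  · obtain ⟨j, hj, hje⟩ := Finset.exists_mem_eq_inf' hne fun n => S n (H x)
    obtain ⟨i, hi, hie⟩ := hSmin (1 + j) x
    have h1 : (Finset.range (N + 1)).inf' hne (fun n => S n x) ≤ S i x :=
      Finset.inf'_le _ (Finset.mem_range.2 (by omega))
    rw [hSadd, Function.iterate_one] at hie
    have h2 : S 1 x = logSlope H x - ψ x := birkhoffSum_one _ _ _
    simp only at hje ⊢
    rw [hje]
    linarith
  · refine le_antisymm ?_ (Finset.le_inf' _ _ fun n _ => ?_)
    · exact (Finset.inf'_le _ (Finset.mem_range.2 (Nat.succ_pos N))).trans (hS0 x).le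
    · rcases hexit x hx with hp | ⟨t, ht, ht'⟩
      · exact (hpar x hp n).ge
      · rcases le_or_gt t n with h | h
        · obtain ⟨m, rfl⟩ := Nat.exists_eq_add_of_le h
          rw [hSadd]
          linarith [(hnear t x ht').1, hSlow m (H^[t] x)]
        · exact (hnear n x fun i hi => ht' i (hi.trans h)).2

end WeaklyExpandingLift

/-! ### Approximation of periodic functions by real analytic ones -/

/-- Uniform continuity of continuous `1`-periodic functions. -/
theorem exists_forall_abs_add_sub_lt {f : ℝ → ℝ} (hc : Continuous f)
    (hp : ∀ (x : ℝ) (k : ℤ), f (x + k) = f x) {ε : ℝ} (hε : 0 < ε) :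
    ∃ s > 0, ∀ x t, 0 ≤ t → t ≤ s → |f (x + t) - f x| < ε := by
  have hu := (isCompact_Icc (a := (0 : ℝ)) (b := 2)).uniformContinuousOn_of_continuous
    hc.continuousOn
  obtain ⟨δ, hδ, h⟩ := Metric.uniformContinuousOn_iff.1 hu ε hε
  refine ⟨min (δ / 2) 1, by positivity, fun x t ht hts => ?_⟩
  have h1 := hp (Int.fract x + t) ⌊x⌋
  have h2 := hp (Int.fract x) ⌊x⌋
  rw [add_right_comm, Int.fract_add_floor] at h1
  rw [Int.fract_add_floor] at h2
  have ht1 := hts.trans (min_le_left _ _)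
  have ht2 := hts.trans (min_le_right _ _)
  have h3 := Int.fract_nonneg x
  have h4 := Int.fract_lt_one x
  rw [h1, h2, ← Real.dist_eq]
  refine h _ ⟨by linarith, by linarith⟩ _ ⟨by linarith, by linarith⟩ ?_
  rw [Real.dist_eq, add_sub_cancel_left, abs_of_nonneg ht]
  linarith

open scoped ContDiff in
/-- A trigonometric polynomial is the sum of a constant and of the derivative of a trigonometric
polynomial. -/
theorem exists_primitive_of_mem_span_fourier {t : C(UnitAddCircle, ℂ)}
    (ht : t ∈ Submodule.span ℂ (range (fourier (T := (1 : ℝ))))) :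
    ∃ (a : ℂ) (T : ℝ → ℂ), (∀ x : ℝ, HasDerivAt T (t (x : UnitAddCircle) - a) x) ∧
      ContDiff ℝ ω T ∧ ∀ x, T (x + 1) = T x := by
  induction ht using Submodule.span_induction with
  | mem t ht =>
    obtain ⟨n, rfl⟩ := ht
    rcases eq_or_ne n 0 with rfl | hn
    · exact ⟨1, fun _ => 0, fun x => by simpa using hasDerivAt_const x (0 : ℂ), contDiff_const,
        fun _ => rfl⟩
    · set c : ℂ := 2 * Real.pi * Complex.I * n with hc
      have hc0 : c ≠ 0 := by
        simp [hc, Real.pi_ne_zero, hn]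
      refine ⟨0, fun x => Complex.exp (c * x) / c, fun x => ?_, ?_, fun x => ?_⟩
      · have h1 : HasDerivAt (fun x : ℝ => c * (x : ℂ)) (c * 1) x :=
          (Complex.ofRealCLM.hasDerivAt (x := x)).const_mul c
        have h2 := (h1.cexp).div_const c
        refine h2.congr_deriv ?_
        rw [fourier_coe_apply, mul_one, mul_div_cancel_right₀ _ hc0, hc]
        simp only [Complex.ofReal_one, div_one, sub_zero]
      · exact ((contDiff_const.mul Complex.ofRealCLM.contDiff).cexp).div_const c
      · have h1 : Complex.exp c = 1 := by
          rw [hc, Complex.exp_eq_one_iff]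
          exact ⟨n, by ring⟩
        simp only [Complex.ofReal_add, Complex.ofReal_one, mul_add, mul_one, Complex.exp_add, h1]
  | zero => exact ⟨0, fun _ => 0, fun x => by simpa using hasDerivAt_const x (0 : ℂ),
      contDiff_const, fun _ => rfl⟩
  | add t₁ t₂ _ _ h₁ h₂ =>
    obtain ⟨a₁, T₁, hd₁, hs₁, hp₁⟩ := h₁
    obtain ⟨a₂, T₂, hd₂, hs₂, hp₂⟩ := h₂
    refine ⟨a₁ + a₂, fun x => T₁ x + T₂ x, fun x => ?_, hs₁.add hs₂,
      fun x => by simp only [hp₁, hp₂]⟩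
    refine ((hd₁ x).add (hd₂ x)).congr_deriv ?_
    rw [ContinuousMap.add_apply]
    ring
  | smul b t _ h =>
    obtain ⟨a, T, hd, hs, hp⟩ := h
    refine ⟨b * a, fun x => b * T x, fun x => ?_, contDiff_const.mul hs, fun x => by simp only [hp]⟩
    refine ((hd x).const_mul b).congr_deriv ?_
    rw [ContinuousMap.smul_apply, smul_eq_mul]
    ring

/-- Real analytic `1`-periodic functions are `C¹`-dense in the `C¹` `1`-periodic functions. -/
theorem exists_analytic_approx {F g : ℝ → ℝ} (hF : ∀ x, HasDerivAt F (g x) x)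
    (hg : Continuous g) (hFp : ∀ x, F (x + 1) = F x) (hgp : ∀ x, g (x + 1) = g x)
    {c : ℝ} (hc : 0 < c) :
    ∃ τ τ' : ℝ → ℝ, AnalyticOnNhd ℝ τ univ ∧ (∀ x, HasDerivAt τ (τ' x) x) ∧
      (∀ x, τ (x + 1) = τ x) ∧ (∀ x, |τ x - F x| ≤ c) ∧ ∀ x, |τ' x - g x| ≤ c := by
  have hper : Function.Periodic (fun x => (g x : ℂ)) (1 : ℝ) := fun x => by simp only [hgp]
  have hcont : Continuous (hper.lift : UnitAddCircle → ℂ) :=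
    continuous_coinduced_dom.2 (Complex.continuous_ofReal.comp hg)
  set G : C(UnitAddCircle, ℂ) := ⟨hper.lift, hcont⟩ with hG
  have hmem : G ∈ closure (Submodule.span ℂ (range (fourier (T := (1 : ℝ)))) :
      Set C(UnitAddCircle, ℂ)) := by
    rw [← Submodule.topologicalClosure_coe, span_fourier_closure_eq_top]
    exact trivial
  obtain ⟨t, ht, htG⟩ := Metric.mem_closure_iff.1 hmem (c / 2) (half_pos hc)
  obtain ⟨a, T, hd, hs, hp⟩ := exists_primitive_of_mem_span_fourier ht
  have hclose : ∀ x : ℝ, |(t (x : UnitAddCircle)).re - g x| ≤ c / 2 := fun x => by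
    have h1 := (ContinuousMap.dist_apply_le_dist (f := G) (g := t) (x : UnitAddCircle)).trans htG.le
    have h2 : G (x : UnitAddCircle) = (g x : ℂ) := rfl
    rw [h2, dist_comm, Complex.dist_eq] at h1
    have h3 := (Complex.abs_re_le_norm _).trans h1
    simpa using h3
  have hdr : ∀ x : ℝ, HasDerivAt (fun x => (T x).re) ((t (x : UnitAddCircle)).re - a.re) x :=
    fun x => Complex.reCLM.hasFDerivAt.comp_hasDerivAt x (hd x)
  have ha : |a.re| ≤ c / 2 := by
    have hD : ∀ x : ℝ, HasDerivAt (fun x => (T x).re - F x)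
        ((t (x : UnitAddCircle)).re - a.re - g x) x := fun x => (hdr x).sub (hF x)
    -- The function `T - F` is periodic, so its derivative vanishes at some point `ξ`.
    obtain ⟨ξ, -, hξ⟩ := exists_hasDerivAt_eq_zero (a := 0) (b := 1) one_pos
      (fun x _ => (hD x).continuousAt.continuousWithinAt) (by
        have h1 := hp 0
        have h2 := hFp 0
        rw [zero_add] at h1 h2
        simp only [h1, h2]) fun x _ => hD x
    have h1 : a.re = (t (ξ : UnitAddCircle)).re - g ξ := by linarith
    rw [h1]
    exact hclose ξ
  have hder : ∀ x : ℝ, |(t (x : UnitAddCircle)).re - a.re - g x| ≤ c := fun x => by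
    have h1 := abs_sub ((t (x : UnitAddCircle)).re - g x) a.re
    rw [sub_right_comm]
    linarith [hclose x]
  -- The constant `e` makes the approximation exact at `0`; then it is enough to bound derivatives.
  set e := F 0 - (T 0).re with he
  refine ⟨fun x => (T x).re + e, fun x : ℝ => (t (x : UnitAddCircle)).re - a.re, ?_,
    fun x => (hdr x).add_const e, fun x => by simp only [hp], fun x => ?_, hder⟩
  · rw [← contDiff_omega_iff_analyticOnNhd]
    exact (Complex.reCLM.contDiff.comp hs).add contDiff_const
  · have hDp : Function.Periodic (fun x => (T x).re + e - F x) 1 := fun x => by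
      simp only [hp, hFp]
    have h1 := hDp.sub_zsmul_eq (x := x) ⌊x⌋
    simp only [zsmul_eq_mul, mul_one, Int.self_sub_floor] at h1
    rw [← h1]
    have h2 := Convex.norm_image_sub_le_of_norm_hasDerivWithin_le (s := Icc (0 : ℝ) 1)
      (f := fun x => (T x).re + e - F x) (C := c) (x := 0) (y := Int.fract x)
      (fun y _ => (((hdr y).add_const e).sub (hF y)).hasDerivWithinAt)
      (fun y _ => hder y) (convex_Icc _ _) ⟨le_rfl, zero_le_one⟩
      ⟨Int.fract_nonneg x, (Int.fract_lt_one x).le⟩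
    rw [Real.norm_eq_abs, Real.norm_eq_abs, sub_zero, abs_of_nonneg (Int.fract_nonneg x)] at h2
    have h3 : (T 0).re + e - F 0 = 0 := by rw [he]; ring
    rw [h3, sub_zero] at h2
    exact h2.trans (mul_le_of_le_one_right hc.le (Int.fract_lt_one x).le)

/-- A continuous `1`-periodic function `f` that vanishes where `Q < δ` has real analytic
approximations with small Lipschitz constant on the intervals contained in `{Q < δ / 2}`: average
`f` over short intervals to make it `C¹`, then approximate in the `C¹` topology. -/
theorem exists_analytic_approx_of_eq_zero {f Q : ℝ → ℝ} (hf : Continuous f)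
    (hfp : ∀ (x : ℝ) (k : ℤ), f (x + k) = f x) (hQ : Continuous Q)
    (hQp : ∀ (x : ℝ) (k : ℤ), Q (x + k) = Q x) {δ : ℝ} (hδ : 0 < δ)
    (hf0 : ∀ x, Q x < δ → f x = 0) {c : ℝ} (hc : 0 < c) :
    ∃ τ : ℝ → ℝ, AnalyticOnNhd ℝ τ univ ∧ (∀ x, τ (x + 1) = τ x) ∧ (∀ x, |τ x - f x| ≤ c) ∧
      ∀ x y, (∀ ξ ∈ uIcc x y, Q ξ < δ / 2) → |τ y - τ x| ≤ c * |y - x| := by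
  obtain ⟨s₁, hs₁, h₁⟩ := exists_forall_abs_add_sub_lt hf hfp (half_pos hc)
  obtain ⟨s₂, hs₂, h₂⟩ := exists_forall_abs_add_sub_lt hQ hQp (half_pos hδ)
  set s := min s₁ s₂ with hs
  have hs0 : 0 < s := lt_min hs₁ hs₂
  have hI : ∀ x, HasDerivAt (fun u => ∫ y in (0 : ℝ)..u, f y) (f x) x := fun x =>
    intervalIntegral.integral_hasDerivAt_right (hf.intervalIntegrable _ _)
      (hf.stronglyMeasurableAtFilter _ _) hf.continuousAt
  -- `F` is the average of `f` over `[x, x + s]`, and `g` is its derivative.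
  set I : ℝ → ℝ := fun u => ∫ y in (0 : ℝ)..u, f y with hIdef
  set F : ℝ → ℝ := fun x => (I (x + s) - I x) / s with hF
  set g : ℝ → ℝ := fun x => (f (x + s) - f x) / s with hg
  have hFd : ∀ x, HasDerivAt F (g x) x := fun x =>
    (((hI (x + s)).comp_add_const x s).sub (hI x)).div_const s
  have hfp1 : ∀ x, f (x + 1) = f x := fun x => by simpa using hfp x 1
  have hgp : ∀ x, g (x + 1) = g x := fun x => by
    simp only [hg, add_right_comm x 1 s, hfp1]
  have hFp : ∀ x, F (x + 1) = F x := fun x => by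
    have h1 : ∀ x, F x = (∫ y in x..(x + s), f y) / s := fun x => by
      simp only [hF, hIdef]
      rw [intervalIntegral.integral_interval_sub_left (hf.intervalIntegrable _ _)
        (hf.intervalIntegrable _ _)]
    rw [h1, h1, add_right_comm, ← intervalIntegral.integral_comp_add_right]
    simp only [hfp1]
  have hFf : ∀ x, |F x - f x| ≤ c / 2 := fun x => by
    obtain ⟨ξ, hξ, he⟩ := exists_hasDerivAt_eq_slope I f (show x < x + s by linarith)
      (fun y _ => (hI y).continuousAt.continuousWithinAt) fun y _ => hI y
    have h3 : F x = f ξ := by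
      rw [he, add_sub_cancel_left]
    have h4 := h₁ x (ξ - x) (by linarith [hξ.1])
      (by linarith [hξ.2, min_le_left s₁ s₂])
    rw [add_sub_cancel] at h4
    rw [h3]
    exact h4.le
  obtain ⟨τ, τ', ha, hd, hp, hτ, hτ'⟩ := exists_analytic_approx hFd
    (((hf.comp (continuous_id.add continuous_const)).sub hf).div_const s) hFp hgp (half_pos hc)
  refine ⟨τ, ha, hp, fun x => ?_, fun x y hxy => ?_⟩
  · have := abs_sub_le (τ x) (F x) (f x)
    linarith [hτ x, hFf x]
  · refine Convex.norm_image_sub_le_of_norm_hasDerivWithin_le (s := uIcc x y) (f := τ)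
      (fun z _ => (hd z).hasDerivWithinAt) (fun z hz => ?_) (convex_uIcc x y) left_mem_uIcc
      right_mem_uIcc
    have hz1 := hxy z hz
    have h3 : f z = 0 := hf0 z (by linarith)
    have h4 : f (z + s) = 0 := by
      refine hf0 _ ?_
      have := (abs_lt.1 (h₂ z s hs0.le (min_le_right _ _))).2
      linarith
    have h5 := hτ' z
    simp only [hg, h3, h4, sub_zero, zero_div] at h5
    rw [Real.norm_eq_abs]
    linarith

/-! ### A trigonometric polynomial that vanishes at the parabolic points -/

theorem sin_sq_add_int (x : ℝ) (k : ℤ) :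
    Real.sin (Real.pi * (x + k)) ^ 2 = Real.sin (Real.pi * x) ^ 2 := by
  rw [mul_add, mul_comm Real.pi (k : ℝ), Real.sin_add_int_mul_pi, mul_pow, ← zpow_natCast,
    ← zpow_mul, mul_comm k, zpow_mul]
  norm_num

theorem sin_sq_eq_zero_iff (x : ℝ) : Real.sin (Real.pi * x) ^ 2 = 0 ↔ ∃ k : ℤ, x = k := by
  rw [sq_eq_zero_iff, Real.sin_eq_zero_iff]
  refine exists_congr fun k => ?_
  rw [mul_comm Real.pi, mul_left_inj' Real.pi_ne_zero, eq_comm]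

/-- A function with a double zero at `p` grows, to the right of `p`, at least as fast as the
exponential function. -/
theorem exists_growth_right {p : ℝ} {S : ℝ → ℝ} (hS : ContDiff ℝ 1 S) (hp : 0 < S p) :
    ∃ r > 0, ∀ x y, p ≤ x → x ≤ y → y ≤ p + r →
      Real.sin (Real.pi * (x - p)) ^ 2 * S x * (y - x) ≤
        Real.sin (Real.pi * (y - p)) ^ 2 * S y - Real.sin (Real.pi * (x - p)) ^ 2 * S x := by
  set s : ℝ → ℝ := fun x => Real.sin (Real.pi * (x - p)) with hs
  set A : ℝ → ℝ := fun x => 2 * (Real.pi * Real.cos (Real.pi * (x - p))) * S x + s x * deriv S x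
    with hA
  set q : ℝ → ℝ := fun x => s x ^ 2 * S x with hq
  have hsd : ∀ x, HasDerivAt s (Real.pi * Real.cos (Real.pi * (x - p))) x := fun x => by
    have h1 : HasDerivAt (fun x => Real.pi * (x - p)) (Real.pi * 1) x :=
      ((hasDerivAt_id x).sub_const p).const_mul Real.pi
    have h2 := h1.sin
    rw [mul_one, mul_comm] at h2
    exact h2
  have hSd : ∀ x, HasDerivAt S (deriv S x) x := fun x =>
    (hS.differentiable one_ne_zero x).hasDerivAt
  have hqd : ∀ x, HasDerivAt q (s x * A x) x := fun x => by
    have := ((hsd x).pow 2).mul (hSd x)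
    refine this.congr_deriv ?_
    simp only [hA, Nat.cast_ofNat, Nat.add_one_sub_one, pow_one, Pi.pow_apply]
    ring
  have hsc : Continuous s := by fun_prop
  have hS' : Continuous (deriv S) := hS.continuous_deriv le_rfl
  have hAc : Continuous A := by
    have := hS.continuous
    fun_prop
  -- The derivative `s * A` of `q = s ^ 2 * S` exceeds `q` where `A > s * S`, which holds near `p`.
  have hBc : Continuous fun x => A x - s x * S x := hAc.sub (hsc.mul hS.continuous)
  have hBp : 0 < A p - s p * S p := by
    simp only [hA, hs, sub_self, mul_zero, Real.cos_zero, Real.sin_zero, zero_mul, add_zero,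
      sub_zero, mul_one]
    have := Real.pi_pos
    positivity
  have hev := ((hBc.tendsto p).eventually (lt_mem_nhds hBp)).and
    ((hS.continuous.tendsto p).eventually (lt_mem_nhds hp))
  obtain ⟨r, hr, h⟩ := Metric.eventually_nhds_iff.1 hev
  refine ⟨min (r / 2) 1, by positivity, fun x y hpx hxy hyp => ?_⟩
  have hr1 := min_le_left (r / 2) 1
  have hr2 := min_le_right (r / 2) 1
  have hs0 : ∀ z, p ≤ z → z ≤ y → 0 ≤ s z := fun z hz hzy =>
    Real.sin_nonneg_of_nonneg_of_le_pi (mul_nonneg Real.pi_pos.le (by linarith))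
      (mul_le_of_le_one_right Real.pi_pos.le (by linarith))
  have hge : ∀ z, p ≤ z → z ≤ y → q z ≤ s z * A z ∧ 0 ≤ q z := fun z hz hzy => by
    obtain ⟨h1, h2⟩ := h (y := z) (by
      rw [Real.dist_eq, abs_lt]
      constructor <;> linarith)
    have h3 := hs0 z hz hzy
    refine ⟨?_, mul_nonneg (sq_nonneg _) h2.le⟩
    have := mul_nonneg h3 h1.le
    simp only [hq]
    nlinarith
  rcases hxy.eq_or_lt with rfl | hlt
  · simp
  have hmono : MonotoneOn q (Icc x y) := by
    refine monotoneOn_of_deriv_nonneg (convex_Icc _ _)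
      (fun z _ => (hqd z).continuousAt.continuousWithinAt)
      (fun z _ => (hqd z).differentiableAt.differentiableWithinAt) fun z hz => ?_
    rw [interior_Icc] at hz
    rw [(hqd z).deriv]
    obtain ⟨h1, h2⟩ := hge z (hpx.trans hz.1.le) hz.2.le
    linarith
  obtain ⟨ξ, hξ, he⟩ := exists_hasDerivAt_eq_slope q _ hlt
    (fun z _ => (hqd z).continuousAt.continuousWithinAt) fun z _ => hqd z
  have h1 := (hge ξ (hpx.trans hξ.1.le) hξ.2.le).1
  have h2 := hmono ⟨le_rfl, hxy⟩ ⟨hξ.1.le, hξ.2.le⟩ hξ.1.le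
  rw [eq_div_iff (by linarith)] at he
  change q x * (y - x) ≤ q y - q x
  rw [← he]
  exact mul_le_mul_of_nonneg_right (h2.trans h1) (by linarith)

/-- A function with a double zero at `p` grows along steps that lead away from `p`. -/
theorem exists_growth {p : ℝ} {S : ℝ → ℝ} (hS : ContDiff ℝ 1 S) (hp : 0 < S p) :
    ∃ r > 0, ∀ x y, (p ≤ x ∧ x ≤ y ∧ y ≤ p + r) ∨ (p - r ≤ y ∧ y ≤ x ∧ x ≤ p) →
      Real.sin (Real.pi * (x - p)) ^ 2 * S x * |y - x| ≤
        Real.sin (Real.pi * (y - p)) ^ 2 * S y - Real.sin (Real.pi * (x - p)) ^ 2 * S x := by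
  obtain ⟨r₁, hr₁, h₁⟩ := exists_growth_right hS hp
  obtain ⟨r₂, hr₂, h₂⟩ := exists_growth_right (p := -p) (S := fun x => S (-x))
    (hS.comp contDiff_neg) (by rwa [neg_neg])
  refine ⟨min r₁ r₂, lt_min hr₁ hr₂, fun x y hxy => ?_⟩
  rcases hxy with ⟨h, h', h''⟩ | ⟨h, h', h''⟩
  · rw [abs_of_nonneg (by linarith)]
    exact h₁ x y h h' (h''.trans (by linarith [min_le_left r₁ r₂]))
  · have hsin : ∀ z : ℝ, Real.sin (Real.pi * (-z - -p)) ^ 2 = Real.sin (Real.pi * (z - p)) ^ 2 :=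
      fun z => by
        rw [show Real.pi * (-z - -p) = -(Real.pi * (z - p)) by ring, Real.sin_neg, neg_sq]
    have := h₂ (-x) (-y) (by linarith) (by linarith) (by linarith [min_le_right r₁ r₂])
    rw [hsin, hsin, neg_neg, neg_neg] at this
    rw [abs_of_nonpos (by linarith)]
    convert this using 2
    ring

namespace WeaklyExpandingLift

variable {d : ℕ} {H P : ℝ → ℝ} {V : ℝ} {Q : ℝ → ℝ}

open scoped ContDiff in
/-- The product of the functions `sin (π (x - p)) ^ 2` over the parabolic points `p` is a real
analytic gauge that grows along orbits that move away from a parabolic point. -/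
theorem exists_gauge (R : WeaklyExpandingLift d H P V)
    (hfix : ∀ p ∈ parabolic H, ∃ k : ℤ, H p = p + k) :
    ∃ Q : ℝ → ℝ, ParabolicGauge H Q ∧ ContDiff ℝ ω Q ∧ ∀ p ∈ parabolic H, ∃ r > 0, ∀ x y,
      (p ≤ x ∧ x ≤ y ∧ y ≤ p + r) ∨ (p - r ≤ y ∧ y ≤ x ∧ x ≤ p) →
        Q x * |y - x| ≤ Q y - Q x := by
  classical
  set F := R.finite_parabolic.toFinset with hF
  have hper : ∀ (E : Finset ℝ) (x : ℝ) (k : ℤ), ∏ p ∈ E, Real.sin (Real.pi * (x + k - p)) ^ 2 =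
      ∏ p ∈ E, Real.sin (Real.pi * (x - p)) ^ 2 := fun E x k =>
    Finset.prod_congr rfl fun p _ => by rw [add_sub_right_comm, sin_sq_add_int]
  have hsm : ∀ (n : WithTop ℕ∞) (E : Finset ℝ),
      ContDiff ℝ n fun x => ∏ p ∈ E, Real.sin (Real.pi * (x - p)) ^ 2 :=
    fun n E => contDiff_prod fun p _ => by fun_prop
  have hzero : ∀ x p : ℝ, Real.sin (Real.pi * (x - p)) ^ 2 = 0 ↔ ∃ k : ℤ, x = p + k :=
    fun x p => by
      rw [sin_sq_eq_zero_iff]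
      exact exists_congr fun k => by rw [sub_eq_iff_eq_add']
  have hfr : ∀ x ∈ parabolic H, Int.fract x ∈ F := fun x hx => by
    refine R.finite_parabolic.mem_toFinset.2 ⟨?_, Int.fract_nonneg x, Int.fract_lt_one x⟩
    have := R.parabolic_add_int hx (-⌊x⌋)
    rwa [Int.cast_neg, ← sub_eq_add_neg, Int.self_sub_floor] at this
  refine ⟨fun x => ∏ p ∈ F, Real.sin (Real.pi * (x - p)) ^ 2, ⟨(hsm 0 F).continuous, hper F,
    fun x => Finset.prod_nonneg fun _ _ => sq_nonneg _, fun x => ?_, hfix⟩, hsm ω F,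
    fun p hp => ?_⟩
  · rw [Finset.prod_eq_zero_iff]
    constructor
    · rintro ⟨p, hpF, hp⟩
      obtain ⟨k, rfl⟩ := (hzero x p).1 hp
      exact R.parabolic_add_int (R.finite_parabolic.mem_toFinset.1 hpF).1 k
    · intro hx
      exact ⟨Int.fract x, hfr x hx, (hzero _ _).2 ⟨⌊x⌋, (Int.fract_add_floor x).symm⟩⟩
  · have hS : 0 < ∏ q ∈ F.erase (Int.fract p), Real.sin (Real.pi * (p - q)) ^ 2 := by
      refine Finset.prod_pos fun q hq => lt_of_le_of_ne (sq_nonneg _) fun h => ?_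
      obtain ⟨hne, hqF⟩ := Finset.mem_erase.1 hq
      obtain ⟨k, hk⟩ := (hzero _ _).1 h.symm
      refine hne ?_
      rw [hk, Int.fract_add_intCast]
      exact (Int.fract_eq_self.2 (R.finite_parabolic.mem_toFinset.1 hqF).2).symm
    obtain ⟨r, hr, h⟩ := exists_growth (hsm 1 (F.erase (Int.fract p))) hS
    have hQ : ∀ x : ℝ, ∏ q ∈ F, Real.sin (Real.pi * (x - q)) ^ 2 =
        Real.sin (Real.pi * (x - p)) ^ 2 *
          ∏ q ∈ F.erase (Int.fract p), Real.sin (Real.pi * (x - q)) ^ 2 := fun x => by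
      rw [← Finset.mul_prod_erase F _ (hfr p hp), ← sin_sq_add_int (x - p) ⌊p⌋, Int.fract,
        sub_sub_eq_add_sub, add_sub_right_comm]
    refine ⟨r, hr, fun x y hxy => ?_⟩
    simp only [hQ]
    exact h x y hxy

/-! ### A real analytic solution of the cohomological inequality -/

/-- Near the parabolic points the map moves points away from them, so the gauge increases. -/
theorem ParabolicGauge.exists_increase (G : ParabolicGauge H Q) (R : WeaklyExpandingLift d H P V)
    (hgrow : ∀ p ∈ parabolic H, ∃ r > 0, ∀ x y,
      (p ≤ x ∧ x ≤ y ∧ y ≤ p + r) ∨ (p - r ≤ y ∧ y ≤ x ∧ x ≤ p) → Q x * |y - x| ≤ Q y - Q x)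
    {δ : ℝ} (hδ : 0 < δ) :
    ∃ δ' > 0, ∀ x, Q x < δ' → ∃ y, (∃ k : ℤ, H x = y + k) ∧
      Q x * |y - x| ≤ Q y - Q x ∧ ∀ ξ ∈ uIcc x y, Q ξ < δ := by
  refine G.exists_lt_subset (U := {x | ∃ y, (∃ k : ℤ, H x = y + k) ∧
    Q x * |y - x| ≤ Q y - Q x ∧ ∀ ξ ∈ uIcc x y, Q ξ < δ}) (fun p hp => ?_) fun x l hx => ?_
  · obtain ⟨k, hk⟩ := G.fixed p hp
    obtain ⟨r, hr, hg⟩ := hgrow p hp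
    obtain ⟨δ₀, hδ₀, hexp⟩ := R.exists_expanding hk
    obtain ⟨δ₁, hδ₁, hQ⟩ := Metric.eventually_nhds_iff.1 ((G.continuous.tendsto p).eventually
      (gt_mem_nhds (show Q p < δ by rwa [(G.eq_zero_iff p).2 hp])))
    have hc : Tendsto (fun x => H x - k) (𝓝 p) (𝓝 p) := by
      have := (R.continuous.tendsto p).sub_const (k : ℝ)
      rwa [hk, add_sub_cancel_right] at this
    filter_upwards [Metric.ball_mem_nhds p hδ₀, Metric.ball_mem_nhds p hδ₁,
      hc (Metric.ball_mem_nhds p hr), hc (Metric.ball_mem_nhds p hδ₁)] with x h0 h1 h2 h3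
    refine ⟨H x - k, ⟨k, by ring⟩, hg _ _ ?_, fun ξ hξ => hQ ?_⟩
    · have h4 : |H x - k - p| < r := by rwa [← Real.dist_eq]
      obtain ⟨h5, h6⟩ := abs_lt.1 h4
      have h7 : |x - p| < δ₀ := by rwa [← Real.dist_eq]
      have h8 : |p - p| < δ₀ := by rwa [sub_self, abs_zero]
      rcases lt_trichotomy p x with h | h | h
      · have := hexp p x h8 h7 (Or.inl le_rfl) h
        exact Or.inl ⟨h.le, by linarith, by linarith⟩
      · subst h
        exact Or.inl ⟨le_rfl, by linarith, by linarith⟩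
      · have := hexp x p h7 h8 (Or.inr le_rfl) h
        exact Or.inr ⟨by linarith, by linarith, h.le⟩
    · have := (convex_ball p δ₁).ordConnected.uIcc_subset h1 h3 hξ
      exact this
  · obtain ⟨y, ⟨k, hk⟩, h1, h2⟩ := hx
    refine ⟨y + l, ⟨k + d * l - l, ?_⟩, ?_, fun ξ hξ => ?_⟩
    · rw [R.map_add_int, hk]
      push_cast
      ring
    · rw [G.add_int, G.add_int, add_sub_add_right_eq_sub]
      exact h1
    · have h3 := G.add_int (ξ - l) l
      rw [sub_add_cancel] at h3
      rw [h3]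
      refine h2 _ ?_
      rw [mem_uIcc] at hξ ⊢
      rcases hξ with h | h
      · exact Or.inl ⟨by linarith [h.1], by linarith [h.2]⟩
      · exact Or.inr ⟨by linarith [h.1], by linarith [h.2]⟩

/-- At the zeros of `Q` the quotient has the junk value `0`, which agrees with the values nearby. -/
theorem ParabolicGauge.continuous_div (G : ParabolicGauge H Q) {v : ℝ → ℝ} (hv : Continuous v)
    {δ : ℝ} (hδ : 0 < δ) (h : ∀ x, Q x < δ → v x = 0) : Continuous fun x => v x / Q x := by
  rw [continuous_iff_continuousAt]
  intro x
  rcases eq_or_ne (Q x) 0 with hx | hx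
  · have hev : (fun x => v x / Q x) =ᶠ[𝓝 x] fun _ => 0 := by
      filter_upwards [(G.continuous.tendsto x).eventually (gt_mem_nhds (show Q x < δ by
        rwa [hx]))] with y hy
      rw [h y hy, zero_div]
    exact continuousAt_const.congr hev.symm
  · exact hv.continuousAt.div G.continuous.continuousAt hx

/-- If all parabolic points are fixed modulo `1`, then `log H'` is cohomologous, by a real analytic
coboundary, to a function that is positive except at the parabolic points. -/
theorem exists_analytic_coboundary (R : WeaklyExpandingLift d H P V)
    (hfix : ∀ p ∈ parabolic H, ∃ k : ℤ, H p = p + k) :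
    ∃ u : ℝ → ℝ, AnalyticOnNhd ℝ u univ ∧ (∀ x, u (x + 1) = u x) ∧
      ∀ x, x ∉ parabolic H → 0 < u (H x) - u x + logSlope H x := by
  obtain ⟨Q, G, hQa, hgrow⟩ := R.exists_gauge hfix
  obtain ⟨ψ, v, hψ, hv, hψp, hvp, hψ0, hle, δ₁, hδ₁, hv0⟩ := G.exists_coboundary R
  obtain ⟨δ₂, hδ₂, hpos⟩ := G.exists_pos R
  obtain ⟨δ₃, hδ₃, hinc⟩ := G.exists_increase R hgrow (half_pos hδ₁)
  set δ := min δ₂ δ₃ with hδ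
  have hδ0 : 0 < δ := lt_min hδ₂ hδ₃
  obtain ⟨m, hm, hψm⟩ : ∃ m > 0, ∀ x, δ ≤ Q x → m ≤ ψ x := by
    obtain ⟨m, hm, h⟩ := (isCompact_Icc (a := (0 : ℝ)) (b := 1)).inter_right
      (isClosed_le continuous_const G.continuous : IsClosed {x | δ ≤ Q x})
      |>.exists_forall_le' hψ.continuousOn (a := 0) fun x hx => hψ0 x fun hxp => by
        have h1 := (G.eq_zero_iff x).2 hxp
        have h2 : δ ≤ Q x := hx.2
        linarith
    refine ⟨m, hm, fun x hx => ?_⟩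
    have h1 := hψp (Int.fract x) ⌊x⌋
    have h2 := G.add_int (Int.fract x) ⌊x⌋
    rw [Int.fract_add_floor] at h1 h2
    rw [h1]
    exact h _ ⟨⟨Int.fract_nonneg x, (Int.fract_lt_one x).le⟩, hx.trans h2.le⟩
  obtain ⟨M₀, hM₀⟩ := exists_abs_le_of_periodic G.continuous G.add_int
  set M := max M₀ 1 with hMdef
  have hM : ∀ x, Q x ≤ M := fun x => (le_abs_self _).trans ((hM₀ x).trans (le_max_left _ _))
  have hM0 : 0 < M := lt_of_lt_of_le one_pos (le_max_right _ _)
  -- The solution is `Q * (2 * c + τ)`, where `τ` is analytic and within `c` of `v / Q`: the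
  -- coefficient of `Q` is at least `c` near the parabolic points, and the difference to `v` is at
  -- most `3 * c * M`.
  set c := m / (16 * M) with hc
  have hc0 : 0 < c := by positivity
  have hMc : M * c = m / 16 := by
    rw [hc]
    field_simp
  set f : ℝ → ℝ := fun x => v x / Q x with hf
  have hf0 : ∀ x, Q x < δ₁ → f x = 0 := fun x hx => by simp only [hf, hv0 x hx, zero_div]
  have hQf : ∀ x, Q x * f x = v x := fun x => by
    rcases eq_or_ne (Q x) 0 with h | h
    · rw [h, zero_mul, hv0 x (by rwa [h])]
    · exact mul_div_cancel₀ _ h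
  obtain ⟨τ, hτa, hτp, hτf, hτl⟩ := exists_analytic_approx_of_eq_zero (f := f) (Q := Q)
    (G.continuous_div hv hδ₁ hv0) (fun x k => by simp only [hf, hvp, G.add_int]) G.continuous
    G.add_int hδ₁ hf0 hc0
  have hτk : ∀ (x : ℝ) (k : ℤ), τ (x + k) = τ x := fun x k => by
    simpa using (show Function.Periodic τ 1 from hτp).int_mul k x
  refine ⟨fun x => Q x * (2 * c + τ x), ?_, fun x => ?_, fun x hx => ?_⟩
  · exact (contDiff_omega_iff_analyticOnNhd.1 hQa).mul (analyticOnNhd_const.add hτa)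
  · have := G.add_int x 1
    rw [Int.cast_one] at this
    simp only [hτp, this]
  rcases lt_or_ge (Q x) δ with h | h
  · -- here `v` vanishes, and the growth of `Q` compensates the variation of `τ`
    have hlog := (hpos x (h.trans_le (min_le_left _ _))).resolve_left hx
    obtain ⟨y, ⟨k, hk⟩, h1, h2⟩ := hinc x (h.trans_le (min_le_right _ _))
    have h3 := hτl x y h2
    have h4 := hτf y
    rw [hf0 y (by linarith [h2 y right_mem_uIcc]), sub_zero] at h4
    simp only [hk, G.add_int, hτk]
    have h5 := mul_le_mul_of_nonneg_right h1
      (show 0 ≤ 2 * c + τ y by linarith [(abs_le.1 h4).1])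
    have h6 := mul_le_mul_of_nonneg_left (show c ≤ 2 * c + τ y by linarith [(abs_le.1 h4).1])
      (mul_nonneg (G.nonneg x) (abs_nonneg (y - x)))
    have h7 := mul_le_mul_of_nonneg_left (abs_le.1 h3).1 (G.nonneg x)
    linarith
  · -- here `u` is uniformly close to `v`
    have hclose : ∀ z, |Q z * (2 * c + τ z) - v z| ≤ 3 * (m / 16) := fun z => by
      rw [← hQf z, ← mul_sub, abs_mul, abs_of_nonneg (G.nonneg z), ← hMc]
      have h1 : |2 * c + τ z - f z| ≤ 3 * c := by
        have := abs_le.1 (hτf z)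
        rw [abs_le]
        constructor <;> linarith
      calc Q z * |2 * c + τ z - f z| ≤ M * (3 * c) :=
            mul_le_mul (hM z) h1 (abs_nonneg _) hM0.le
        _ = 3 * (M * c) := by ring
    have h1 := (abs_le.1 (hclose x)).2
    have h2 := (abs_le.1 (hclose (H x))).1
    have h3 := hψm x h
    have h4 := hle x
    linarith

end WeaklyExpandingLift

/-! ### Circle maps and their lifts -/

theorem UnitAddCircle.coe_eq_coe_iff {s t : ℝ} :
    (s : UnitAddCircle) = (t : UnitAddCircle) ↔ ∃ k : ℤ, s = t + k := by
  rw [← sub_eq_zero, ← AddCircle.coe_sub, AddCircle.coe_eq_zero_iff]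
  refine exists_congr fun k => ?_
  rw [zsmul_eq_mul, mul_one, eq_sub_iff_add_eq', eq_comm]

namespace IsCircleLift

variable {d : ℕ} {h : UnitAddCircle → UnitAddCircle} {H : ℝ → ℝ}

theorem iterate (hH : IsCircleLift d h H) (n : ℕ) : IsCircleLift (d ^ n) h^[n] H^[n] where
  continuous := hH.continuous.iterate n
  lift t := by
    induction n with
    | zero => rfl
    | succ n ih => rw [Function.iterate_succ_apply', hH.lift, ih, Function.iterate_succ_apply']
  degree t := by
    have hnat : ∀ (t : ℝ) (m : ℕ), H (t + m) = H t + m • (d : ℝ) := fun t m =>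
      AddConstMapClass.map_add_nat' (⟨H, hH.degree⟩ : AddConstMap ℝ ℝ 1 (d : ℝ)) t m
    induction n with
    | zero => simp
    | succ n ih =>
      rw [Function.iterate_succ_apply', ih, hnat, Function.iterate_succ_apply', nsmul_eq_mul,
        pow_succ]
      push_cast
      ring

theorem iterate_coe (hH : IsCircleLift d h H) (n : ℕ) (t : ℝ) :
    h^[n] (t : UnitAddCircle) = ((H^[n] t : ℝ) : UnitAddCircle) :=
  ((hH.iterate n).lift t).symm

theorem isPeriodicPt_iff (hH : IsCircleLift d h H) {n : ℕ} {t : ℝ} :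
    Function.IsPeriodicPt h n (t : UnitAddCircle) ↔ ∃ k : ℤ, H^[n] t = t + k := by
  rw [Function.IsPeriodicPt, Function.IsFixedPt, hH.iterate_coe, UnitAddCircle.coe_eq_coe_iff]

theorem circleDeriv_iterate (hH : IsCircleLift d h H) (hd : Differentiable ℝ H)
    (hpos : ∀ t, 0 < deriv H t) (n : ℕ) (t : ℝ) :
    circleDeriv h^[n] (t : UnitAddCircle) = Real.exp (expo H n t) := by
  rw [(hH.iterate n).circleDeriv_eq, (hasDerivAt_iterate_exp_expo hd hpos n t).deriv]

/-- At a periodic point, the derivative of any iterate that fixes the point exceeds `1` on a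
punctured neighbourhood, if the derivative of the iterate that belongs to the minimal period does
at every periodic point. -/
theorem eventually_expo_pos (hH : IsCircleLift d h H) (hinj : Function.Injective H)
    (hd : Differentiable ℝ H) (hpos : ∀ t, 0 < deriv H t)
    (hexp : ∀ p ∈ Function.periodicPts h,
      ∃ U ∈ 𝓝 p, ∀ x ∈ U \ {p}, 1 < circleDeriv (h^[Function.minimalPeriod h p]) x)
    {r : ℕ} (hr : 1 ≤ r) {k : ℤ} {p : ℝ} (hp : H^[r] p = p + k) :
    ∀ᶠ x in 𝓝[≠] p, 0 < expo H r x := by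
  have hper : Function.IsPeriodicPt h r (p : UnitAddCircle) := hH.isPeriodicPt_iff.2 ⟨k, hp⟩
  have hmem := Function.mk_mem_periodicPts hr hper
  set s := Function.minimalPeriod h (p : UnitAddCircle) with hs
  obtain ⟨q, rfl⟩ : s ∣ r := hper.minimalPeriod_dvd
  have hq : q ≠ 0 := by
    rintro rfl
    simp at hr
  obtain ⟨U, hU, hUp⟩ := hexp _ hmem
  have hlocal : ∀ p' : ℝ, (p' : UnitAddCircle) = (p : UnitAddCircle) →
      ∀ᶠ x in 𝓝[≠] p', 0 < expo H s x := fun p' hp' => by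
    have hcont : Tendsto (fun x : ℝ => (x : UnitAddCircle)) (𝓝 p') (𝓝 (p : UnitAddCircle)) := by
      rw [← hp']
      exact (AddCircle.continuous_mk' (1 : ℝ)).tendsto p'
    filter_upwards [mem_nhdsWithin_of_mem_nhds (hcont hU),
      mem_nhdsWithin_of_mem_nhds (Metric.ball_mem_nhds p' one_pos), self_mem_nhdsWithin]
      with x hxU hx1 hxp
    have hne : (x : UnitAddCircle) ≠ (p : UnitAddCircle) := fun he => by
      obtain ⟨m, hm⟩ := UnitAddCircle.coe_eq_coe_iff.1 (he.trans hp'.symm)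
      rw [Metric.mem_ball, hm, Real.dist_eq, add_sub_cancel_left] at hx1
      have h0 : m = 0 := Int.abs_lt_one_iff.1 (by exact_mod_cast hx1)
      exact hxp (by simp [hm, h0])
    have := hUp _ ⟨hxU, hne⟩
    rwa [hH.circleDeriv_iterate hd hpos, Real.one_lt_exp_iff] at this
  -- By the chain rule, the derivative of `H^[s * q]` is a product of derivatives of `H^[s]` near
  -- points of the orbit of `p` under `H^[s]`, which all project to `p`.
  have hind : ∀ q : ℕ, ∀ᶠ x in 𝓝[≠] p, 0 < expo H (s * (q + 1)) x := by
    intro q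
    induction q with
    | zero => simpa using hlocal p rfl
    | succ q ih =>
      have htend : Tendsto H^[s * (q + 1)] (𝓝[≠] p) (𝓝[≠] (H^[s * (q + 1)] p)) :=
        tendsto_nhdsWithin_of_tendsto_nhds_of_eventually_within _
          (((hH.continuous.iterate _).tendsto p).mono_left nhdsWithin_le_nhds)
          (eventually_mem_nhdsWithin.mono fun x hx => (hinj.iterate _).ne hx)
      have hfix : ((H^[s * (q + 1)] p : ℝ) : UnitAddCircle) = (p : UnitAddCircle) := by
        rw [← hH.iterate_coe]
        exact (Function.isPeriodicPt_minimalPeriod h (p : UnitAddCircle)).mul_const (q + 1)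
      filter_upwards [ih, htend (hlocal _ hfix)] with x h1 h2
      have h2' : 0 < expo H s (H^[s * (q + 1)] x) := h2
      rw [Nat.mul_succ s (q + 1), expo_add]
      exact add_pos h1 h2'
  obtain ⟨q, rfl⟩ := Nat.exists_eq_succ_of_ne_zero hq
  exact hind q

end IsCircleLift

/-- The increments of a `1`-periodic function of bounded variation are dominated by those of a
function `P` with `P (t + 1) = P t + V`. -/
theorem exists_control {g : ℝ → ℝ} (hg : Function.Periodic g 1)
    (hbv : BoundedVariationOn g (Icc 0 1)) :
    ∃ (P : ℝ → ℝ) (V : ℝ), (∀ t, P (t + 1) = P t + V) ∧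
      ∀ x y, x ≤ y → |g y - g x| ≤ P y - P x := by
  obtain ⟨p, q, hp, hq, rfl⟩ :=
    hbv.locallyBoundedVariationOn.exists_monotoneOn_sub_monotoneOn
  -- If `g = p - q` with `p` and `q` increasing, then `p + q` dominates `g`.
  set w : ℝ → ℝ := fun x => p x + q x with hw
  have hle : ∀ x ∈ Icc (0 : ℝ) 1, ∀ y ∈ Icc (0 : ℝ) 1, x ≤ y →
      |(p - q) y - (p - q) x| ≤ w y - w x := fun x hx y hy hxy => by
    have h1 := hp hx hy hxy
    have h2 := hq hx hy hxy
    simp only [hw, Pi.sub_apply]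
    rw [abs_le]
    constructor <;> linarith
  set g := p - q with hgdef
  refine ⟨fun x => ⌊x⌋ * (w 1 - w 0) + w (Int.fract x), w 1 - w 0, fun t => ?_, fun x y hxy => ?_⟩
  · simp only [Int.floor_add_one, Int.fract_add_one]
    push_cast
    ring
  have hfr : ∀ z, g z = g (Int.fract z) := fun z => by
    have := hg.sub_zsmul_eq (x := z) ⌊z⌋
    rw [zsmul_eq_mul, mul_one, Int.self_sub_floor] at this
    exact this.symm
  have hmem : ∀ z : ℝ, Int.fract z ∈ Icc (0 : ℝ) 1 := fun z =>
    ⟨Int.fract_nonneg z, (Int.fract_lt_one z).le⟩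
  have h0 : (0 : ℝ) ∈ Icc (0 : ℝ) 1 := ⟨le_rfl, zero_le_one⟩
  have h1 : (1 : ℝ) ∈ Icc (0 : ℝ) 1 := ⟨zero_le_one, le_rfl⟩
  simp only
  rw [hfr x, hfr y]
  rcases (Int.floor_mono hxy).eq_or_lt with he | hlt
  · have hxy' : Int.fract x ≤ Int.fract y := by
      simp only [Int.fract, he]
      linarith
    have := hle _ (hmem x) _ (hmem y) hxy'
    rw [he]
    linarith
  · have h2 := hle _ h0 _ (hmem y) (hmem y).1
    have h3 := hle _ (hmem x) _ h1 (hmem x).2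
    have h4 : g 1 = g 0 := by simpa using hg 0
    rw [h4] at h3
    have h5 := abs_sub_le (g (Int.fract y)) (g 0) (g (Int.fract x))
    have h6 := (abs_nonneg _).trans (hle 0 h0 1 h1 zero_le_one)
    have h7 : ((⌊x⌋ : ℝ) + 1) * (w 1 - w 0) ≤ ⌊y⌋ * (w 1 - w 0) :=
      mul_le_mul_of_nonneg_right (by exact_mod_cast hlt) h6
    linarith

namespace IsTdStar

variable {d : ℕ} {h : UnitAddCircle → UnitAddCircle}

theorem exists_weaklyExpandingLift (hd : 2 ≤ d) (hh : IsTdStar d h) :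
    ∃ (H P : ℝ → ℝ) (V : ℝ), IsCircleLift d h H ∧ WeaklyExpandingLift d H P V := by
  obtain ⟨⟨H, hH, hC, hpos, hbv⟩, hexp⟩ := hh
  have hdiff : Differentiable ℝ H := hC.differentiable one_ne_zero
  have hcd : Continuous (deriv H) := hC.continuous_deriv le_rfl
  have hper : Function.Periodic (deriv H) 1 := fun t => by
    have h1 : (fun s => H (s + 1)) = fun s => H s + d := funext hH.degree
    have h2 := congrArg (fun f => deriv f t) h1
    simpa only [deriv_comp_add_const, deriv_add_const] using h2
  obtain ⟨m, hm, hmle⟩ : ∃ m > 0, ∀ t, m ≤ deriv H t := by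
    obtain ⟨m, hm, hle⟩ := (isCompact_Icc (a := (0 : ℝ)) (b := 1)).exists_forall_le'
      hcd.continuousOn (a := 0) fun t _ => hpos t
    refine ⟨m, hm, fun t => ?_⟩
    have := hper.sub_zsmul_eq (x := t) ⌊t⌋
    rw [zsmul_eq_mul, mul_one, Int.self_sub_floor] at this
    rw [← this]
    exact hle _ ⟨Int.fract_nonneg t, (Int.fract_lt_one t).le⟩
  have hlog : ∀ x y, logSlope H y - logSlope H x ≤ |deriv H y - deriv H x| / m := fun x y => by
    have h1 := Real.log_le_sub_one_of_pos (div_pos (hpos y) (hpos x))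
    rw [Real.log_div (hpos y).ne' (hpos x).ne', div_sub_one (hpos x).ne'] at h1
    exact h1.trans (div_le_div₀ (abs_nonneg _) (le_abs_self _) hm (hmle x))
  obtain ⟨P, V, hP, hle⟩ := exists_control hper hbv
  have hlogabs : ∀ x y, x ≤ y → |logSlope H y - logSlope H x| ≤ P y / m - P x / m :=
    fun x y hxy => by
      have h3 := div_le_div_of_nonneg_right (hle x y hxy) hm.le
      rw [sub_div] at h3
      have h4 := hlog y x
      rw [abs_sub_comm] at h4
      rw [abs_le]
      constructor <;> linarith [hlog x y]
  refine ⟨H, fun x => P x / m, V / m, hH, hd, hdiff, hcd, hpos, hH.degree, fun x y hxy => ?_,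
    fun t => by simp only [hP, add_div], hlogabs, fun r hr k p hp => ?_⟩
  · have := (abs_nonneg _).trans (hlogabs x y hxy)
    exact sub_nonneg.1 this
  · exact hH.eventually_expo_pos (strictMono_of_deriv_pos hpos).injective hdiff hpos hexp hr hp

end IsTdStar

namespace WeaklyExpandingLift

variable {d : ℕ} {h : UnitAddCircle → UnitAddCircle} {H P : ℝ → ℝ} {V : ℝ}

theorem coe_mem_parabolicPts_iff (R : WeaklyExpandingLift d H P V) (hH : IsCircleLift d h H)
    {t : ℝ} : (t : UnitAddCircle) ∈ parabolicPts h ↔ t ∈ parabolic H := by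
  constructor
  · rintro ⟨hmem, hder⟩
    obtain ⟨k, hk⟩ := hH.isPeriodicPt_iff.1
      (Function.isPeriodicPt_minimalPeriod h (t : UnitAddCircle))
    rw [hH.circleDeriv_iterate R.differentiable R.deriv_pos, Real.exp_eq_one_iff] at hder
    exact ⟨_, Function.minimalPeriod_pos_of_mem_periodicPts hmem, k, hk, hder⟩
  · rintro ⟨r, hr, k, hk, he⟩
    have hper : Function.IsPeriodicPt h r (t : UnitAddCircle) := hH.isPeriodicPt_iff.2 ⟨k, hk⟩
    refine ⟨Function.mk_mem_periodicPts hr hper, ?_⟩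
    rw [hH.circleDeriv_iterate R.differentiable R.deriv_pos, Real.exp_eq_one_iff]
    obtain ⟨l, hl⟩ := hH.isPeriodicPt_iff.1
      (Function.isPeriodicPt_minimalPeriod h (t : UnitAddCircle))
    obtain ⟨q, hq⟩ := hper.minimalPeriod_dvd
    have h1 := (R.periodic_mul hl q).2
    rw [← hq, he] at h1
    refine (mul_eq_zero.1 h1.symm).resolve_left ?_
    rintro h0
    rw [Nat.cast_eq_zero] at h0
    rw [h0, mul_zero] at hq
    omega

theorem finite_parabolicPts (R : WeaklyExpandingLift d H P V) (hH : IsCircleLift d h H) :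
    (parabolicPts h).Finite := by
  refine (R.finite_parabolic.image ((↑) : ℝ → UnitAddCircle)).subset fun x hx => ?_
  obtain ⟨t, ht, rfl⟩ : x ∈ ((↑) : ℝ → UnitAddCircle) '' Ico 0 (0 + 1) := by
    rw [AddCircle.coe_image_Ico_eq]
    exact trivial
  rw [zero_add] at ht
  exact ⟨t, ⟨(R.coe_mem_parabolicPts_iff hH).1 hx, ht⟩, rfl⟩

theorem parabolic_iterate_subset (R : WeaklyExpandingLift d H P V) {n : ℕ} (hn : 1 ≤ n) :
    parabolic H^[n] ⊆ parabolic H := by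
  rintro p ⟨r, hr, k, hk, he⟩
  rw [R.expo_iterate] at he
  rw [← Function.iterate_mul] at hk
  exact ⟨n * r, Nat.one_le_iff_ne_zero.2 (by positivity), k, hk, he⟩

end WeaklyExpandingLift

theorem mainTheorem2 (d : ℕ) (hd : 2 ≤ d) (h : UnitAddCircle → UnitAddCircle)
    (hh : IsTdStar d h) :
    (parabolicPts h).Finite ∧
    ∃ N : ℕ, 0 < N ∧ ∃ ρ : UnitAddCircle → ℝ, IsAnalyticOnCircle ρ ∧ (∀ x, 0 < ρ x) ∧
      ∀ x, x ∉ parabolicPts h →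
        1 < ρ (h^[N] x) / ρ x * circleDeriv (h^[N]) x := by
  obtain ⟨H, P, V, hH, R⟩ := hh.exists_weaklyExpandingLift hd
  have hfin := R.finite_parabolicPts hH
  -- The iterate `h^[N]` fixes every parabolic point, and has no other parabolic points.
  set N := ∏ p ∈ hfin.toFinset, Function.minimalPeriod h p with hN
  have hN0 : 0 < N := Finset.prod_pos fun p hp =>
    Function.minimalPeriod_pos_of_mem_periodicPts (hfin.mem_toFinset.1 hp).1
  have hsub := R.parabolic_iterate_subset hN0
  have hfix : ∀ p ∈ WeaklyExpandingLift.parabolic H^[N], ∃ k : ℤ, H^[N] p = p + k :=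
    fun p hp => by
      have hmem := (R.coe_mem_parabolicPts_iff hH).2 (hsub hp)
      exact hH.isPeriodicPt_iff.1 ((Function.isPeriodicPt_minimalPeriod h _).trans_dvd
        (Finset.dvd_prod_of_mem _ (hfin.mem_toFinset.2 hmem)))
  obtain ⟨u, hu, hup, hpos⟩ := (R.iterate hN0).exists_analytic_coboundary hfix
  have huper : Function.Periodic u 1 := hup
  refine ⟨hfin, N, hN0, fun x => Real.exp (huper.lift x), ?_, fun x => Real.exp_pos _,
    fun x hx => ?_⟩
  · exact fun t _ => (hu t (mem_univ t)).rexp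
  · obtain ⟨t, rfl⟩ := QuotientAddGroup.mk_surjective x
    have h1 := hpos t fun ht => hx ((R.coe_mem_parabolicPts_iff hH).2 (hsub ht))
    rw [R.logSlope_iterate] at h1
    change 1 < Real.exp (huper.lift (h^[N] (t : UnitAddCircle))) /
      Real.exp (huper.lift (t : UnitAddCircle)) * circleDeriv h^[N] (t : UnitAddCircle)
    rw [hH.iterate_coe, hH.circleDeriv_iterate R.differentiable R.deriv_pos, ← Real.exp_sub,
      ← Real.exp_add, Real.one_lt_exp_iff]
    exact h1
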